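/- For a prime power $q$ let $\mathbb{F}_q$ be the finite field with $q$ elements. A \emph{Steinhaus random multiplicative function} over $\mathbb{F}_q[t]$ is a random function $f$ from the monic polynomials of $\mathbb{F}_q[t]$ to $\mathbb{C}$ such that the values $f(P)$, for $P$ monic irreducible, are independent random variables uniformly distributed on the unit circle $\{z\in\mathbb{C}:|z|=1\}$, and $f(1)=1$, $f(F)=f(P_1)^{a_1}\cdots f(P_r)^{a_r}$ whenever $F=P_1^{a_1}\cdots P_r^{a_r}$ with distinct monic irreducible $P_1,\dots,P_r$. Write $\mathcal{CN}(0,1)$ for the standard complex normal distribution, whose real and imaginary parts are independent real normal variables of mean $0$ and variance $1/2$. Consider a family of pairs $(q,N)$, with $q$ a prime power and $N\ge 1$ an integer, along which $q^N\to\infty$; here $q$ and $N$ may vary and depend on each other arbitrarily (for instance $q$ fixed and $N\to\infty$, or $N$ fixed and $q\to\infty$). For each member of the family let $\mathcal{A}=\mathcal{A}_{N,q}$ be a set of monic polynomials of degree $N$ in $\mathbb{F}_q[t]$, let $\mathcal{S}=\mathcal{S}_{N,q}\subseteq\mathcal{A}$ be a subset, and let $f$ be a Steinhaus random multiplicative function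 over $\mathbb{F}_q[t]$. Suppose that there is a constant $c>0$, independent of $q$ and $N$, such that (for all sufficiently large $q^N$) $$|\mathcal{A}|\;\ge\; c\,q^N\exp\!\big(-\tfrac13\sqrt{N\log q}\,\big),$$ and that, as $q^N\to\infty$, $$|\mathcal{S}|=(1+o(1))\,|\mathcal{A}|,\qquad \big|\{(F_1,F_2,G_1,G_2)\in\mathcal{S}^4: F_1F_2=G_1G_2\}\big|=(2+o(1))\,|\mathcal{S}|^2 .$$ Then $$\frac{1}{\sqrt{|\mathcal{A}|}}\sum_{F\in\mathcal{A}}f(F)\;\xrightarrow{\;d\;}\;\mathcal{CN}(0,1)\qquad\text{as } q^N\to\infty,$$ where $\xrightarrow{d}$ denotes convergence in distribution of complex random variables. -/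

import Mathlib

open MeasureTheory ProbabilityTheory Filter Topology Polynomial

/-- The uniform distribution on the unit circle `{z : |z| = 1}`, as a measure on `ℂ`:
the law of `exp (2πiθ)` for `θ` uniform on `(0, 1]`. -/
noncomputable def uniformUnitCircle : Measure ℂ :=
  (volume.restrict (Set.Ioc (0 : ℝ) 1)).map
    fun θ : ℝ => Complex.exp (2 * Real.pi * θ * Complex.I)

/-- The standard complex normal distribution `CN(0,1)`: real and imaginary parts are
independent centred real Gaussians of variance `1/2`. -/
noncomputable def stdComplexNormal : Measure ℂ :=
  ((gaussianReal 0 (1 / 2)).prod (gaussianReal 0 (1 / 2))).map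
    Complex.measurableEquivRealProd.symm

instance : IsProbabilityMeasure stdComplexNormal :=
  Measure.isProbabilityMeasure_map Complex.measurableEquivRealProd.symm.measurable.aemeasurable

/-- `f` is a Steinhaus random multiplicative function over `K[t]`: the variables `f P`, for `P`
monic irreducible, are independent and uniform on the unit circle, and `f` is given on a monic
polynomial `∏ P ^ a P` (with distinct monic irreducible `P`) by `∏ (f P) ^ a P`; the empty
product gives `f 1 = 1`. Only the values of `f` at monic polynomials matter. -/
structure IsSteinhaus {K Ω : Type*} [Field K] [MeasurableSpace Ω]
    (f : K[X] → Ω → ℂ) (μ : Measure Ω) : Prop where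
  hasLaw : ∀ P : K[X], P.Monic → Irreducible P → HasLaw (f P) uniformUnitCircle μ
  indep : iIndepFun (fun P : {P : K[X] // P.Monic ∧ Irreducible P} => f P) μ
  map_prod_pow : ∀ (s : Finset K[X]) (a : K[X] → ℕ), (∀ P ∈ s, P.Monic ∧ Irreducible P) →
    ∀ ω, f (∏ P ∈ s, P ^ a P) ω = ∏ P ∈ s, f P ω ^ a P

open Classical in
/-- The multiplicative energy of a finite set of polynomials: the number of quadruples
`(F₁, F₂, G₁, G₂) ∈ S⁴` with `F₁ * F₂ = G₁ * G₂`. -/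
noncomputable def multEnergy {K : Type*} [Field K] (S : Finset K[X]) : ℕ :=
  Finset.mulEnergy S S

/-! ### The uniform law on the unit circle and its characteristic function. -/

section Circle

open ComplexConjugate

/-! Put $s=\sqrt{N\log q}$ and call a prime $P$ large when $q^{\deg P}>e^{s/2}$. Rankin's method
shows that at most $q^N e^{-s/2}$ times a power of $s$ polynomials of degree $N$ have no large prime
factor, and a similar bound holds for those divisible by the square of a large prime
(`card_exceptional_le`). Since $|\mathcal A|\ge c\,q^N e^{-s/3}$, these form a proportion
$O(s^4e^{-s/6})$ of $\mathcal A$. By orthogonality, discarding them together with $\mathcal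
A\setminus\mathcal S$ changes the normalised sum by $o(1)$ in $L^2$.

Enumerate the large primes as $p_0,\dots,p_{n-1}$, in any order, and group the remaining $F$ by the
largest $k$ with $p_k\mid F$. As $p_k^2\nmid F$, the $k$-th group contributes $f(p_k)W_k$, where
$W_k$ depends only on $f$ at primes other than $p_k,\dots,p_{n-1}$. The sum is thus a martingale
whose increments are a uniform point of the circle times a predictable factor.

For such sums the conditional variance of an increment is, up to a constant, $|W_k|^2$, which equals
the squared modulus of the increment itself. The central limit theorem
`norm_integral_exp_sum_sub_gaussian_le` therefore needs only that $\sum E|W_k|^4$ and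
$E|\sum|W_k|^2-1|$ be small. Both are controlled by the multiplicative energies $E(G_k,G_l)$ of the
groups. The trivial solutions contribute the main term plus $\sum|G_k|^2\le D|\mathcal A|$, where
$D=q^Ne^{-s/2}$ bounds the number of multiples of a large prime. The nontrivial solutions, over all
$k,l$ together, are at most those in $\mathcal S$, hence $o(|\mathcal S|^2)$ by the energy
hypothesis.

The resulting bound on characteristic functions is explicit (`norm_charFun_steinhausSum_sub_le`),
and Lévy's continuity theorem gives the limit. -/

lemma measurable_circleParam :
    Measurable (fun θ : ℝ => Complex.exp (2 * Real.pi * θ * Complex.I)) := by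
  fun_prop

instance isProbabilityMeasure_uniformUnitCircle : IsProbabilityMeasure uniformUnitCircle := by
  have : IsProbabilityMeasure (volume.restrict (Set.Ioc (0 : ℝ) 1)) := ⟨by simp⟩
  exact Measure.isProbabilityMeasure_map measurable_circleParam.aemeasurable

lemma ae_norm_eq_one_uniformUnitCircle : ∀ᵐ u ∂uniformUnitCircle, ‖u‖ = 1 := by
  rw [uniformUnitCircle, ae_map_iff measurable_circleParam.aemeasurable
    (measurableSet_eq_fun measurable_norm measurable_const)]
  filter_upwards with θ
  have : (2 * Real.pi * θ * Complex.I : ℂ) = ((2 * Real.pi * θ : ℝ) : ℂ) * Complex.I := by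
    push_cast; ring
  rw [this, Complex.norm_exp_ofReal_mul_I]

/-- The mixed moments of the uniform distribution on the unit circle. -/
lemma integral_pow_mul_conj_pow_uniformUnitCircle (a b : ℕ) :
    ∫ u, u ^ a * conj u ^ b ∂uniformUnitCircle = if a = b then 1 else 0 := by
  rw [uniformUnitCircle, integral_map measurable_circleParam.aemeasurable
    (by fun_prop : Measurable fun u : ℂ => u ^ a * conj u ^ b).aestronglyMeasurable]
  have key : ∀ θ : ℝ, Complex.exp (2 * Real.pi * θ * Complex.I) ^ a *
      conj (Complex.exp (2 * Real.pi * θ * Complex.I)) ^ b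
      = Complex.exp ((2 * Real.pi * Complex.I * ((a : ℤ) - (b : ℤ) : ℤ)) * θ) := by
    intro θ
    rw [← Complex.exp_conj, ← Complex.exp_nat_mul, ← Complex.exp_nat_mul, ← Complex.exp_add]
    congr 1
    simp [Complex.conj_ofNat]
    ring
  simp_rw [key]
  rw [← intervalIntegral.integral_of_le zero_le_one]
  split_ifs with h
  · simp [h]
  · have hc : (2 * Real.pi * Complex.I * ((a : ℤ) - (b : ℤ) : ℤ) : ℂ) ≠ 0 := by
      refine mul_ne_zero Complex.two_pi_I_ne_zero ?_
      exact Int.cast_ne_zero.mpr (by omega)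
    rw [integral_exp_mul_complex hc]
    have : Complex.exp (2 * Real.pi * Complex.I * ((a : ℤ) - (b : ℤ) : ℤ)) = 1 := by
      rw [Complex.exp_eq_one_iff]
      exact ⟨(a : ℤ) - b, by ring⟩
    simp only [Complex.ofReal_one, mul_one, this]
    simp

lemma integrable_pow_mul_conj_pow_uniformUnitCircle (c : ℂ) (a b : ℕ) :
    Integrable (fun u => c * (u ^ a * conj u ^ b)) uniformUnitCircle := by
  refine Integrable.of_bound (C := ‖c‖)
    (by fun_prop : Measurable fun u : ℂ => c * (u ^ a * conj u ^ b)).aestronglyMeasurable ?_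
  filter_upwards [ae_norm_eq_one_uniformUnitCircle] with u hu
  simp [hu]

/-- Third order Taylor expansion of `exp (x * I)`. -/
lemma norm_exp_mul_I_sub_taylor_le (x : ℝ) :
    ‖Complex.exp (x * Complex.I) -
      (1 + x * Complex.I - x ^ 2 / 2 - x ^ 3 / 6 * Complex.I)‖ ≤ 4 * x ^ 4 := by
  have hx4 : |x| ^ 4 = x ^ 4 := by rw [← abs_pow, abs_of_nonneg (by positivity)]
  have hx : ‖(x * Complex.I : ℂ)‖ = |x| := by simp
  rcases le_or_gt |x| 1 with h | h
  · have := Complex.exp_bound (x := x * Complex.I) (by rw [hx]; exact h) (n := 4) (by norm_num)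
    rw [hx, hx4] at this
    have e : ∑ m ∈ Finset.range 4, (x * Complex.I : ℂ) ^ m / (m.factorial : ℂ)
        = 1 + x * Complex.I - x ^ 2 / 2 - x ^ 3 / 6 * Complex.I := by
      simp only [Finset.sum_range_succ, Finset.sum_range_zero, Nat.factorial]
      have : Complex.I ^ 3 = - Complex.I := by rw [pow_succ, Complex.I_sq]; ring
      simp only [mul_pow, Complex.I_sq, this]
      push_cast
      ring
    rw [e] at this
    refine this.trans ?_
    norm_num [Nat.factorial]
    nlinarith [pow_nonneg (abs_nonneg x) 4]
  -- For $|x|>1$ every term is at most a multiple of $x^4$, so the triangle inequality suffices.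
  · have h1 : ‖Complex.exp (x * Complex.I)‖ = 1 := Complex.norm_exp_ofReal_mul_I x
    have h2 : ‖(1 + x * Complex.I - x ^ 2 / 2 - x ^ 3 / 6 * Complex.I : ℂ)‖
        ≤ 1 + |x| + |x| ^ 2 / 2 + |x| ^ 3 / 6 := by
      refine (norm_sub_le _ _).trans (add_le_add ((norm_sub_le _ _).trans
        (add_le_add ((norm_add_le _ _).trans ?_) ?_)) ?_) <;> simp
    refine (norm_sub_le _ _).trans ?_
    rw [h1, ← hx4]
    have e1 : 1 ≤ |x| ^ 4 := one_le_pow₀ h.le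
    have e2 : |x| ≤ |x| ^ 4 := by simpa using pow_le_pow_right₀ h.le (show 1 ≤ 4 by norm_num)
    have e3 : |x| ^ 2 ≤ |x| ^ 4 := pow_le_pow_right₀ h.le (by norm_num)
    have e4 : |x| ^ 3 ≤ |x| ^ 4 := pow_le_pow_right₀ h.le (by norm_num)
    linarith

/-- The value at `z` of the characteristic function of the uniform distribution on the unit
circle (a Bessel function of `‖z‖`). -/
noncomputable def circleCharFun (z : ℂ) : ℂ :=
  ∫ u, Complex.exp (((u * z).re : ℝ) * Complex.I) ∂uniformUnitCircle

/-- Expanded in $u$ and $\bar u$, only the constant and the balanced monomial $u\bar u$ survive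
integration; in particular the cubic term vanishes. -/
lemma integral_taylor_uniformUnitCircle (z : ℂ) :
    Integrable (fun u : ℂ => (1 + ((u * z).re : ℝ) * Complex.I - ((u * z).re : ℝ) ^ 2 / 2
      - ((u * z).re : ℝ) ^ 3 / 6 * Complex.I : ℂ)) uniformUnitCircle ∧
    ∫ u, (1 + ((u * z).re : ℝ) * Complex.I - ((u * z).re : ℝ) ^ 2 / 2
      - ((u * z).re : ℝ) ^ 3 / 6 * Complex.I : ℂ) ∂uniformUnitCircle
      = ((1 - ‖z‖ ^ 2 / 4 : ℝ) : ℂ) := by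
  have hre : ∀ w : ℂ, ((w.re : ℝ) : ℂ) = (w + conj w) / 2 := fun w => by
    rw [Complex.add_conj]; push_cast; ring
  set w := conj z with hw
  set I := Complex.I with hI
  have e : (fun u : ℂ => (1 + ((u * z).re : ℝ) * Complex.I - ((u * z).re : ℝ) ^ 2 / 2
      - ((u * z).re : ℝ) ^ 3 / 6 * Complex.I : ℂ)) = fun u =>
      1 * (u ^ 0 * conj u ^ 0) + (I * z / 2 * (u ^ 1 * conj u ^ 0) +
      (I * w / 2 * (u ^ 0 * conj u ^ 1) +
      (-z ^ 2 / 8 * (u ^ 2 * conj u ^ 0) + (-(z * w) / 4 * (u ^ 1 * conj u ^ 1) +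
      (-w ^ 2 / 8 * (u ^ 0 * conj u ^ 2) + (-I * z ^ 3 / 48 * (u ^ 3 * conj u ^ 0) +
      (-I * z ^ 2 * w / 16 * (u ^ 2 * conj u ^ 1) + (-I * z * w ^ 2 / 16 * (u ^ 1 * conj u ^ 2) +
      -I * w ^ 3 / 48 * (u ^ 0 * conj u ^ 3))))))))) := by
    funext u
    rw [hre, map_mul, ← hw]
    ring
  have hi := integrable_pow_mul_conj_pow_uniformUnitCircle
  rw [e]
  constructor
  · repeat' first | apply Integrable.add | apply hi
  · repeat rw [integral_add (by apply hi) (by repeat' first | apply Integrable.add | apply hi)]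
    simp only [integral_const_mul, integral_pow_mul_conj_pow_uniformUnitCircle]
    norm_num
    rw [hw, Complex.mul_conj, Complex.normSq_eq_norm_sq]
    push_cast
    ring

lemma norm_circleCharFun_sub_le (z : ℂ) :
    ‖circleCharFun z - ((1 - ‖z‖ ^ 2 / 4 : ℝ) : ℂ)‖ ≤ 4 * ‖z‖ ^ 4 := by
  obtain ⟨h1, h2⟩ := integral_taylor_uniformUnitCircle z
  rw [circleCharFun, ← h2, ← integral_sub _ h1]
  · refine (norm_integral_le_of_norm_le_const (C := 4 * ‖z‖ ^ 4) ?_).trans (by simp)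
    filter_upwards [ae_norm_eq_one_uniformUnitCircle] with u hu
    refine (norm_exp_mul_I_sub_taylor_le _).trans ?_
    have : |(u * z).re| ≤ ‖z‖ := (Complex.abs_re_le_norm _).trans (by simp [hu])
    have h4 : (u * z).re ^ 4 = |(u * z).re| ^ 4 := by
      rw [← abs_pow, abs_of_nonneg (by positivity)]
    rw [h4]
    gcongr
  · refine Integrable.of_bound (C := 1) (by
      apply Measurable.aestronglyMeasurable; fun_prop) ?_
    filter_upwards with u
    rw [Complex.norm_exp_ofReal_mul_I]

/-- The constant is $65=4\cdot16+1$: with $\|z\|^4=16a^2$ the Taylor error is $64a^2$, and replacing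
$1-a$ by $e^{-a}$ costs at most $a^2$. -/
lemma norm_circleCharFun_sub_exp_le {z : ℂ} {a : ℝ} (ha : a = ‖z‖ ^ 2 / 4) :
    ‖circleCharFun z - (Real.exp (-a) : ℂ)‖ ≤ 65 * a ^ 2 := by
  have ha0 : 0 ≤ a := by rw [ha]; positivity
  have h1 := norm_circleCharFun_sub_le z
  rw [← ha, show ‖z‖ ^ 4 = 16 * a ^ 2 by rw [ha]; ring] at h1
  have h2 : |(1 - a) - Real.exp (-a)| ≤ a ^ 2 := by
    rcases le_or_gt a 1 with h | h
    · have := Real.abs_exp_sub_one_sub_id_le (x := -a) (by rw [abs_neg, abs_of_nonneg ha0]; exact h)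
      rw [neg_sq] at this
      rwa [abs_sub_comm, show Real.exp (-a) - (1 - a) = Real.exp (-a) - 1 - -a by ring]
    · have e1 := Real.add_one_le_exp (-a)
      have e2 : Real.exp (-a) ≤ 1 := Real.exp_le_one_iff.mpr (by linarith)
      rw [abs_le]
      constructor <;> nlinarith
  calc ‖circleCharFun z - (Real.exp (-a) : ℂ)‖
      ≤ ‖circleCharFun z - ((1 - a : ℝ) : ℂ)‖ + ‖((1 - a : ℝ) : ℂ) - (Real.exp (-a) : ℂ)‖ :=
        norm_sub_le_norm_sub_add_norm_sub _ _ _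
    _ ≤ 4 * (16 * a ^ 2) + a ^ 2 := by
        refine add_le_add h1 ?_
        rw [← Complex.ofReal_sub, Complex.norm_real]
        exact h2
    _ = 65 * a ^ 2 := by ring

lemma measurable_circleCharFun : Measurable circleCharFun := by
  have h : Measurable fun p : ℂ × ℂ => Complex.exp (((p.2 * p.1).re : ℝ) * Complex.I) := by
    fun_prop
  exact h.stronglyMeasurable.integral_prod_right'.measurable

lemma norm_circleCharFun_le_one (z : ℂ) : ‖circleCharFun z‖ ≤ 1 := by
  refine (norm_integral_le_of_norm_le_const (C := 1) ?_).trans (by simp)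
  filter_upwards with u
  rw [Complex.norm_exp_ofReal_mul_I]

/-- Averaging over a uniform variable on the circle independent of the rest. -/
lemma IndepFun.integral_mul_exp_eq_circleCharFun {Ω : Type*} [MeasurableSpace Ω] {μ : Measure Ω}
    [IsProbabilityMeasure μ] {R z U : Ω → ℂ} (hR : Measurable R) (hz : Measurable z)
    (hU : Measurable U) {B : ℝ} (hB : ∀ ω, ‖R ω‖ ≤ B)
    (hind : IndepFun (fun ω => (R ω, z ω)) U μ) (hlaw : μ.map U = uniformUnitCircle) :
    ∫ ω, R ω * Complex.exp (((U ω * z ω).re : ℝ) * Complex.I) ∂μ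
      = ∫ ω, R ω * circleCharFun (z ω) ∂μ := by
  have hRz : Measurable fun ω => (R ω, z ω) := hR.prodMk hz
  rw [indepFun_iff_map_prod_eq_prod_map_map hRz.aemeasurable hU.aemeasurable, hlaw] at hind
  have hm : Measurable fun p : (ℂ × ℂ) × ℂ =>
      p.1.1 * Complex.exp (((p.2 * p.1.2).re : ℝ) * Complex.I) := by fun_prop
  have : IsProbabilityMeasure (μ.map fun ω => (R ω, z ω)) :=
    Measure.isProbabilityMeasure_map hRz.aemeasurable
  have e1 := integral_map (μ := μ) (hRz.prodMk hU).aemeasurable hm.aestronglyMeasurable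
  rw [hind, integral_prod] at e1
  · rw [← e1]
    simp only [integral_const_mul]
    change ∫ p : ℂ × ℂ, p.1 * circleCharFun p.2 ∂_ = _
    rw [integral_map hRz.aemeasurable]
    exact (measurable_fst.mul (measurable_circleCharFun.comp measurable_snd)).aestronglyMeasurable
  · rw [← hind, integrable_map_measure hm.aestronglyMeasurable (hRz.prodMk hU).aemeasurable]
    refine Integrable.of_bound (C := B) (hm.comp (hRz.prodMk hU)).aestronglyMeasurable ?_
    filter_upwards with ω
    simp only [Function.comp, norm_mul, Complex.norm_exp_ofReal_mul_I, mul_one, hB ω]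

end Circle

/-! ### A quantitative central limit theorem for rotation-invariant martingale increments. -/

section MartingaleCLT

open ComplexConjugate

variable {Ω : Type*}

lemma exp_neg_sub_exp_neg_le {x y : ℝ} (hx : 0 ≤ x) (hxy : x ≤ y) :
    |Real.exp (-y) - Real.exp (-x)| ≤ y - x := by
  have h1 : Real.exp (-y) = Real.exp (-x) * Real.exp (-(y - x)) := by
    rw [← Real.exp_add]; congr 1; ring
  have h2 := Real.add_one_le_exp (-(y - x))
  have h3 : Real.exp (-x) ≤ 1 := Real.exp_le_one_iff.mpr (by linarith)
  have h4 : Real.exp (-(y - x)) ≤ 1 := Real.exp_le_one_iff.mpr (by linarith)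
  rw [h1, abs_le]
  constructor <;> nlinarith [Real.exp_pos (-x)]

/-- This removes the clipped compensator at the end of the telescoping: nothing is lost when $s\ge
M$, and $1+x\le e^x$ handles $s<M$. -/
lemma exp_sub_exp_min_le (s M : ℝ) :
    |Real.exp (min s M) - Real.exp M| ≤ Real.exp M * |s - M| := by
  rcases le_total s M with h | h
  · rw [min_eq_left h, abs_of_nonpos (by simpa using h), abs_of_nonpos (by linarith)]
    have h1 : Real.exp s = Real.exp M * Real.exp (s - M) := by
      rw [← Real.exp_add]; congr 1; ring
    have h2 := Real.add_one_le_exp (s - M)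
    rw [h1]
    nlinarith [Real.exp_pos M]
  · rw [min_eq_right h]
    simp only [sub_self, abs_zero]
    positivity

/-- One step of the telescoping argument: replacing a rotation-invariant increment
by a Gaussian one with the same conditional variance `a`, up to the clipped compensator. -/
lemma norm_integral_compensated_exp_step_le {m m0 : MeasurableSpace Ω} {μ : Measure Ω}
    [IsProbabilityMeasure μ] (hm : m ≤ m0) {E U z : Ω → ℂ} {s : Ω → ℝ} {M B : ℝ}
    (hE : Measurable[m] E) (hE1 : ∀ ω, ‖E ω‖ = 1) (hz : Measurable[m] z) (hs : Measurable[m] s)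
    (hs0 : ∀ ω, 0 ≤ s ω) (hsB : ∀ ω, s ω ≤ B) (hzB : ∀ ω, ‖z ω‖ ≤ B) (hU : Measurable U)
    (hind : Indep m (MeasurableSpace.comap U inferInstance) μ)
    (hlaw : μ.map U = uniformUnitCircle) :
    ‖∫ ω, (Real.exp (min (s ω + ‖z ω‖ ^ 2 / 4) M) : ℂ) *
          (E ω * Complex.exp (((U ω * z ω).re : ℝ) * Complex.I)) ∂μ
        - ∫ ω, (Real.exp (min (s ω) M) : ℂ) * E ω ∂μ‖
      ≤ Real.exp M * ∫ ω, (65 * (‖z ω‖ ^ 2 / 4) ^ 2 +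
          ((s ω + ‖z ω‖ ^ 2 / 4 - min (s ω + ‖z ω‖ ^ 2 / 4) M) - (s ω - min (s ω) M))) ∂μ := by
  -- The updated weight uses the conditional variance but not $U$, so it is still `m`-measurable and
  -- $U$ can be averaged out. Clipping at $M$ keeps it below $e^M$.
  set R : Ω → ℂ := fun ω => (Real.exp (min (s ω + ‖z ω‖ ^ 2 / 4) M) : ℂ) * E ω with hRdef
  have hRm : Measurable[m] R := by
    refine Measurable.mul ?_ hE
    refine Complex.measurable_ofReal.comp (Real.measurable_exp.comp ?_)
    exact (hs.add (((measurable_norm.comp hz).pow_const 2).div_const 4)).min measurable_const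
  have hRB : ∀ ω, ‖R ω‖ ≤ Real.exp M := fun ω => by
    rw [hRdef]
    simp only [norm_mul, hE1, mul_one, Complex.norm_real, Real.norm_eq_abs, Real.abs_exp]
    exact Real.exp_le_exp.mpr (min_le_right _ _)
  have hz' : Measurable z := hz.mono hm le_rfl
  have hs' : Measurable s := hs.mono hm le_rfl
  have hE' : Measurable E := hE.mono hm le_rfl
  have hR' : Measurable R := hRm.mono hm le_rfl
  have hindep : IndepFun (fun ω => (R ω, z ω)) U μ := by
    rw [IndepFun_iff_Indep]
    refine indep_of_indep_of_le_left hind ?_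
    exact (hRm.prodMk hz).comap_le
  have e1 : ∫ ω, (Real.exp (min (s ω + ‖z ω‖ ^ 2 / 4) M) : ℂ) *
      (E ω * Complex.exp (((U ω * z ω).re : ℝ) * Complex.I)) ∂μ
      = ∫ ω, R ω * circleCharFun (z ω) ∂μ := by
    rw [← IndepFun.integral_mul_exp_eq_circleCharFun hR' hz' hU hRB hindep hlaw]
    simp only [hRdef, mul_assoc]
  have hcint : Integrable (fun ω => R ω * circleCharFun (z ω)) μ := by
    refine Integrable.of_bound (C := Real.exp M * 1)
      (hR'.mul (measurable_circleCharFun.comp hz')).aestronglyMeasurable ?_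
    filter_upwards with ω
    rw [norm_mul]
    exact mul_le_mul (hRB ω) (norm_circleCharFun_le_one _) (norm_nonneg _) (Real.exp_pos _).le
  have hdint : Integrable (fun ω => (Real.exp (min (s ω) M) : ℂ) * E ω) μ := by
    refine Integrable.of_bound (C := Real.exp M) (by
      apply Measurable.aestronglyMeasurable
      exact (Complex.measurable_ofReal.comp (Real.measurable_exp.comp
        (hs'.min measurable_const))).mul hE') ?_
    filter_upwards with ω
    simp only [norm_mul, hE1, mul_one, Complex.norm_real, Real.norm_eq_abs, Real.abs_exp]
    exact Real.exp_le_exp.mpr (min_le_right _ _)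
  rw [e1, ← integral_sub hcint hdint, ← integral_const_mul]
  refine norm_integral_le_of_norm_le ?_ ?_
  · refine Integrable.const_mul (Integrable.of_bound
      (C := 65 * (B ^ 2 / 4) ^ 2 + ((B + B ^ 2 / 4) + (B + B ^ 2 / 4))) ?_ ?_) _
    · apply Measurable.aestronglyMeasurable
      fun_prop
    · filter_upwards with ω
      have ha : 0 ≤ ‖z ω‖ ^ 2 / 4 := by positivity
      have haB : ‖z ω‖ ^ 2 / 4 ≤ B ^ 2 / 4 := by
        have := hzB ω
        gcongr
      have h2 : (‖z ω‖ ^ 2 / 4) ^ 2 ≤ (B ^ 2 / 4) ^ 2 := by gcongr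
      have h3 := hs0 ω
      have h4 := hsB ω
      have h5 : 0 ≤ (‖z ω‖ ^ 2 / 4) ^ 2 := by positivity
      rw [Real.norm_eq_abs, abs_le]
      constructor <;>
        rcases min_cases (s ω + ‖z ω‖ ^ 2 / 4) M with h | h <;>
        rcases min_cases (s ω) M with h' | h' <;> nlinarith
  · filter_upwards with ω
    set a := ‖z ω‖ ^ 2 / 4 with ha
    have ha0 : 0 ≤ a := by positivity
    -- The weight grows by $e^{\Delta}$ rather than $e^{a}$; the defect $a-\Delta\ge0$ is the
    -- increment of the excess $s-\min(s,M)$, so it telescopes.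
    set Δ := min (s ω + a) M - min (s ω) M with hΔ
    have hΔ0 : 0 ≤ Δ := by
      rw [hΔ, sub_nonneg]; exact min_le_min_right _ (by linarith)
    have hΔa : Δ ≤ a := by
      rw [hΔ]
      rcases min_cases (s ω + a) M with h | h <;>
        rcases min_cases (s ω) M with h' | h' <;> linarith
    have e2 : (Real.exp (min (s ω) M) : ℂ) * E ω = R ω * (Real.exp (-Δ) : ℂ) := by
      have : Real.exp (min (s ω) M) = Real.exp (min (s ω + a) M) * Real.exp (-Δ) := by
        rw [← Real.exp_add]; congr 1; rw [hΔ]; ring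
      rw [hRdef, this]
      push_cast
      ring
    rw [e2, ← mul_sub, norm_mul]
    refine mul_le_mul (hRB ω) ?_ (norm_nonneg _) (Real.exp_pos _).le
    calc ‖circleCharFun (z ω) - (Real.exp (-Δ) : ℂ)‖
        ≤ ‖circleCharFun (z ω) - (Real.exp (-a) : ℂ)‖
          + ‖(Real.exp (-a) : ℂ) - (Real.exp (-Δ) : ℂ)‖ :=
          norm_sub_le_norm_sub_add_norm_sub _ _ _
      _ ≤ 65 * a ^ 2 + (a - Δ) := by
          refine add_le_add (norm_circleCharFun_sub_exp_le ha) ?_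
          rw [← Complex.ofReal_sub, Complex.norm_real]
          exact exp_neg_sub_exp_neg_le hΔ0 hΔa
      _ = _ := by rw [hΔ]; ring

/-- Quantitative central limit theorem for sums `∑ U k * W k` in which `U k` is uniform on the
unit circle and independent of a σ-algebra `ℱ k` for which `W k` is measurable. -/
theorem norm_integral_exp_sum_sub_gaussian_le {m0 : MeasurableSpace Ω} {μ : Measure Ω}
    [IsProbabilityMeasure μ] {n : ℕ} {ℱ : ℕ → MeasurableSpace Ω} (hmono : Monotone ℱ) (hle : ∀ k, ℱ k ≤ m0)
    {U W : ℕ → Ω → ℂ} {B : ℝ} (hW : ∀ k < n, Measurable[ℱ k] (W k))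
    (hWB : ∀ k < n, ∀ ω, ‖W k ω‖ ≤ B) (hU : ∀ k < n, Measurable[ℱ (k + 1)] (U k))
    (hind : ∀ k < n, Indep (ℱ k) (MeasurableSpace.comap (U k) inferInstance) μ)
    (hlaw : ∀ k < n, μ.map (U k) = uniformUnitCircle) (t : ℂ) :
    ‖∫ ω, Complex.exp ((((∑ k ∈ Finset.range n, U k ω * W k ω) * conj t).re : ℝ) * Complex.I) ∂μ
        - (Real.exp (-(‖t‖ ^ 2 / 4)) : ℂ)‖
      ≤ 65 * (‖t‖ ^ 2 / 4) ^ 2 * ∑ k ∈ Finset.range n, ∫ ω, ‖W k ω‖ ^ 4 ∂μ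
        + 2 * (‖t‖ ^ 2 / 4) * ∫ ω, |∑ k ∈ Finset.range n, ‖W k ω‖ ^ 2 - 1| ∂μ := by
  set M := ‖t‖ ^ 2 / 4 with hM
  have hM0 : 0 ≤ M := by positivity
  set z : ℕ → Ω → ℂ := fun k ω => W k ω * conj t with hzdef
  set a : ℕ → Ω → ℝ := fun k ω => ‖z k ω‖ ^ 2 / 4 with hadef
  have haM : ∀ k ω, a k ω = M * ‖W k ω‖ ^ 2 := fun k ω => by
    simp only [hadef, hzdef, norm_mul, RCLike.norm_conj, hM]; ring
  set s : ℕ → Ω → ℝ := fun k ω => ∑ j ∈ Finset.range k, a j ω with hsdef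
  set E : ℕ → Ω → ℂ := fun k ω =>
    Complex.exp (((∑ j ∈ Finset.range k, (U j ω * z j ω).re : ℝ)) * Complex.I) with hEdef
  have hzm : ∀ k < n, Measurable[ℱ k] (z k) := fun k hk => (hW k hk).mul_const _
  have ham : ∀ k < n, Measurable[ℱ k] (a k) := fun k hk =>
    ((measurable_norm.comp (hzm k hk)).pow_const 2).div_const 4
  have hsm : ∀ k ≤ n, Measurable[ℱ k] (s k) := fun k hk => by
    refine Finset.measurable_sum _ fun j hj => ?_
    have hj := Finset.mem_range.mp hj
    exact (ham j (by omega)).mono (hmono hj.le) le_rfl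
  have hEm : ∀ k ≤ n, Measurable[ℱ k] (E k) := fun k hk => by
    refine Complex.measurable_exp.comp (Measurable.mul_const
      (Complex.measurable_ofReal.comp (Finset.measurable_sum _ fun j hj => ?_)) _)
    have hj := Finset.mem_range.mp hj
    refine Complex.measurable_re.comp (Measurable.mul ?_ ?_)
    · exact (hU j (by omega)).mono (hmono (by omega)) le_rfl
    · exact (hzm j (by omega)).mono (hmono hj.le) le_rfl
  have hE1 : ∀ k ω, ‖E k ω‖ = 1 := fun k ω => Complex.norm_exp_ofReal_mul_I _
  have ha0 : ∀ k ω, 0 ≤ a k ω := fun k ω => by simp only [hadef]; positivity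
  have hs0 : ∀ k ω, 0 ≤ s k ω := fun k ω => Finset.sum_nonneg fun j _ => ha0 j ω
  have hWB' : ∀ k < n, ∀ ω, ‖W k ω‖ ^ 2 ≤ B ^ 2 := fun k hk ω => by
    have := hWB k hk ω
    gcongr
  have haB : ∀ k < n, ∀ ω, a k ω ≤ M * B ^ 2 := fun k hk ω => by
    rw [haM]; exact mul_le_mul_of_nonneg_left (hWB' k hk ω) hM0
  have hsB : ∀ k ≤ n, ∀ ω, s k ω ≤ k * (M * B ^ 2) := fun k hk ω => by
    refine (Finset.sum_le_card_nsmul _ _ (M * B ^ 2) fun j hj => ?_).trans (by simp)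
    exact haB j (by have := Finset.mem_range.mp hj; omega) ω
  have hainteg : ∀ k < n, Integrable (fun ω => 65 * a k ω ^ 2) μ := fun k hk => by
    refine Integrable.const_mul (Integrable.of_bound (C := (M * B ^ 2) ^ 2)
      (((ham k hk).mono (hle k) le_rfl).pow_const 2).aestronglyMeasurable ?_) _
    filter_upwards with ω
    rw [Real.norm_of_nonneg (by positivity)]
    have := haB k hk ω
    have := ha0 k ω
    gcongr
  have hsmM : ∀ k ≤ n, Measurable (s k) := fun k hk => (hsm k hk).mono (hle k) le_rfl
  have hsinteg : ∀ k ≤ n, Integrable (s k) μ := fun k hk => by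
    refine Integrable.of_bound (C := k * (M * B ^ 2)) (hsmM k hk).aestronglyMeasurable ?_
    filter_upwards with ω
    rw [Real.norm_of_nonneg (hs0 k ω)]
    exact hsB k hk ω
  have hminteg : ∀ k ≤ n, Integrable (fun ω => min (s k ω) M) μ := fun k hk =>
    (hsinteg k hk).inf (integrable_const M)
  have hdinteg : ∀ k ≤ n, Integrable (fun ω => s k ω - min (s k ω) M) μ := fun k hk =>
    (hsinteg k hk).sub (hminteg k hk)
  -- The compensated characteristic function starts at $1$ and drifts by at most the fourth-moment
  -- errors plus the expected excess of the total variance over $M$.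
  have main : ∀ k ≤ n, ‖∫ ω, (Real.exp (min (s k ω) M) : ℂ) * E k ω ∂μ - 1‖
      ≤ Real.exp M * ((∑ j ∈ Finset.range k, ∫ ω, 65 * a j ω ^ 2 ∂μ)
        + ∫ ω, (s k ω - min (s k ω) M) ∂μ) := by
    intro k
    induction k with
    | zero => intro _; simp [hsdef, hEdef, hM0]
    | succ k ih =>
      intro hk
      have ih := ih (by omega)
      have hk' : k < n := by omega
      have step := norm_integral_compensated_exp_step_le (hle k) (E := E k) (U := U k) (z := z k)
        (s := s k) (M := M) (B := max (k * (M * B ^ 2)) (B * ‖t‖)) (hEm k hk'.le) (hE1 k) (hzm k hk')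
        (hsm k hk'.le)
        (hs0 k) (fun ω => (hsB k hk'.le ω).trans (le_max_left _ _)) (fun ω => by
          refine le_trans ?_ (le_max_right _ _)
          simp only [hzdef, norm_mul, RCLike.norm_conj]
          exact mul_le_mul_of_nonneg_right (hWB k hk' ω) (norm_nonneg _))
        ((hU k hk').mono (hle _) le_rfl) (hind k hk') (hlaw k hk')
      have es : ∀ ω, s k ω + ‖z k ω‖ ^ 2 / 4 = s (k + 1) ω := fun ω => by
        simp only [hsdef, Finset.sum_range_succ, hadef]
      have eE : ∀ ω, E k ω * Complex.exp (((U k ω * z k ω).re : ℝ) * Complex.I) = E (k + 1) ω :=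
        fun ω => by
          simp only [hEdef, Finset.sum_range_succ]
          rw [← Complex.exp_add]
          congr 1
          push_cast
          ring
      simp only [es, eE] at step
      have split := (integral_add (hainteg k hk') ((hdinteg _ hk).sub (hdinteg _ hk'.le))).trans
        (congrArg (_ + ·) (integral_sub (hdinteg _ hk) (hdinteg _ hk'.le)))
      replace step := step.trans_eq (congrArg (Real.exp M * ·) split)
      rw [Finset.sum_range_succ]
      refine (norm_sub_le_norm_sub_add_norm_sub _ _ _).trans ((add_le_add step ih).trans ?_)
      apply le_of_eq
      ring
  have hn := main n le_rfl
  have hEint : Integrable (E n) μ := by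
    refine Integrable.of_bound (C := 1) ((hEm n le_rfl).mono (hle n) le_rfl).aestronglyMeasurable ?_
    filter_upwards with ω
    exact (hE1 n ω).le
  have hHint : Integrable (fun ω => (Real.exp (min (s n ω) M) : ℂ) * E n ω) μ := by
    refine Integrable.of_bound (C := Real.exp M) (by
      apply Measurable.aestronglyMeasurable
      exact (Complex.measurable_ofReal.comp (Real.measurable_exp.comp
        ((hsmM n le_rfl).min measurable_const))).mul ((hEm n le_rfl).mono (hle n) le_rfl)) ?_
    filter_upwards with ω
    simp only [norm_mul, hE1, mul_one, Complex.norm_real, Real.norm_eq_abs, Real.abs_exp]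
    exact Real.exp_le_exp.mpr (min_le_right _ _)
  have hV : Integrable (fun ω => |s n ω - M|) μ := ((hsinteg n le_rfl).sub (integrable_const M)).abs
  -- The total variance is close to $M$ in $L^1$, so the final weight may be replaced by the
  -- constant $e^M$. This and the excess in `hd` account for the factor $2$ in the conclusion.
  have hfin : ‖(Real.exp M : ℂ) * ∫ ω, E n ω ∂μ - ∫ ω, (Real.exp (min (s n ω) M) : ℂ) * E n ω ∂μ‖
      ≤ Real.exp M * ∫ ω, |s n ω - M| ∂μ := by
    rw [← integral_const_mul, ← integral_sub (hEint.const_mul _) hHint, ← integral_const_mul]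
    refine norm_integral_le_of_norm_le (hV.const_mul _) ?_
    filter_upwards with ω
    rw [← sub_mul, norm_mul, hE1, mul_one, ← Complex.ofReal_sub, Complex.norm_real,
      Real.norm_eq_abs, abs_sub_comm]
    exact exp_sub_exp_min_le _ _
  have hd : ∫ ω, (s n ω - min (s n ω) M) ∂μ ≤ ∫ ω, |s n ω - M| ∂μ := by
    refine integral_mono (hdinteg n le_rfl) hV fun ω => ?_
    change s n ω - min (s n ω) M ≤ |s n ω - M|
    rcases min_cases (s n ω) M with h | h
    · rw [h.1, sub_self]; positivity
    · rw [h.1]; exact le_abs_self _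
  have eL : ∀ ω, Complex.exp
      ((((∑ k ∈ Finset.range n, U k ω * W k ω) * conj t).re : ℝ) * Complex.I) = E n ω := fun ω => by
    simp only [hEdef, hzdef]
    rw [Finset.sum_mul, Complex.re_sum]
    simp only [mul_assoc]
  simp only [eL]
  have e4 : ∑ j ∈ Finset.range n, ∫ ω, 65 * a j ω ^ 2 ∂μ
      = 65 * M ^ 2 * ∑ k ∈ Finset.range n, ∫ ω, ‖W k ω‖ ^ 4 ∂μ := by
    rw [Finset.mul_sum]
    refine Finset.sum_congr rfl fun j _ => ?_
    rw [← integral_const_mul]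
    congr 1
    funext ω
    rw [haM]
    ring
  have e5 : ∫ ω, |s n ω - M| ∂μ = M * ∫ ω, |∑ k ∈ Finset.range n, ‖W k ω‖ ^ 2 - 1| ∂μ := by
    rw [← integral_const_mul]
    congr 1
    funext ω
    simp only [hsdef, haM]
    rw [← Finset.mul_sum, ← abs_of_nonneg hM0, ← abs_mul, abs_of_nonneg hM0]
    ring_nf
  rw [e4] at hn
  have total : Real.exp M * ‖∫ ω, E n ω ∂μ - (Real.exp (-M) : ℂ)‖
      ≤ Real.exp M * (65 * M ^ 2 * ∑ k ∈ Finset.range n, ∫ ω, ‖W k ω‖ ^ 4 ∂μ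
        + 2 * ∫ ω, |s n ω - M| ∂μ) := by
    have : Real.exp M * ‖∫ ω, E n ω ∂μ - (Real.exp (-M) : ℂ)‖
        = ‖(Real.exp M : ℂ) * ∫ ω, E n ω ∂μ - 1‖ := by
      have h1 : (Real.exp M : ℂ) * (Real.exp (-M) : ℂ) = 1 := by
        rw [← Complex.ofReal_mul, ← Real.exp_add]; simp
      rw [← h1, ← mul_sub, norm_mul, Complex.norm_real, Real.norm_eq_abs, Real.abs_exp]
    rw [this]
    refine (norm_sub_le_norm_sub_add_norm_sub _ _ _).trans ((add_le_add hfin hn).trans ?_)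
    rw [← mul_add]
    refine mul_le_mul_of_nonneg_left ?_ (Real.exp_pos _).le
    linarith
  have := le_of_mul_le_mul_left total (Real.exp_pos M)
  rw [e5] at this
  linarith

end MartingaleCLT

/-! ### Moments of Steinhaus random multiplicative functions. -/

section Steinhaus

open ComplexConjugate UniqueFactorizationMonoid

variable {K Ω : Type*} [Field K]

open Classical in
/-- The completely multiplicative extension, to all polynomials, of a function on monic
irreducible polynomials. -/
noncomputable def multExt (g : K[X] → Ω → ℂ) (F : K[X]) (ω : Ω) : ℂ :=
  ((normalizedFactors F).map fun P => g P ω).prod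

lemma multExt_mul (g : K[X] → Ω → ℂ) {F H : K[X]} (hF : F ≠ 0) (hH : H ≠ 0) (ω : Ω) :
    multExt g (F * H) ω = multExt g F ω * multExt g H ω := by
  classical
  rw [multExt, normalizedFactors_mul hF hH, Multiset.map_add, Multiset.prod_add]
  rfl

lemma multExt_irreducible (g : K[X] → Ω → ℂ) {P : K[X]} (hP : P.Monic) (hi : Irreducible P)
    (ω : Ω) : multExt g P ω = g P ω := by
  classical
  rw [multExt, normalizedFactors_irreducible hi, hP.normalize_eq_self]
  simp

open Classical in
lemma monic_irreducible_of_mem_normalizedFactors {F P : K[X]} (h : P ∈ normalizedFactors F) :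
    P.Monic ∧ Irreducible P := by
  have hi := irreducible_of_normalized_factor P h
  refine ⟨?_, hi⟩
  rw [← normalize_normalized_factor P h]
  exact monic_normalize hi.ne_zero

/-- The σ-algebra is arbitrary and only the prime divisors of $F$ matter; this makes the martingale
factors predictable. -/
lemma measurable_multExt {m : MeasurableSpace Ω} {g : K[X] → Ω → ℂ} {F : K[X]}
    (h : ∀ P : K[X], P.Monic → Irreducible P → P ∣ F → Measurable[m] (g P)) :
    Measurable[m] (multExt g F) := by
  classical
  have : multExt g F = ((normalizedFactors F).map g).prod := by
    funext ω
    rw [multExt, Pi.multiset_prod_apply, Multiset.map_map]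
    rfl
  rw [this]
  refine Multiset.measurable_prod _ fun f hf => ?_
  obtain ⟨P, hP, rfl⟩ := Multiset.mem_map.mp hf
  obtain ⟨h1, h2⟩ := monic_irreducible_of_mem_normalizedFactors hP
  exact h P h1 h2 (dvd_of_mem_normalizedFactors hP)

lemma norm_multExt {g : K[X] → Ω → ℂ} (hg : ∀ P ω, ‖g P ω‖ = 1) (F : K[X]) (ω : Ω) :
    ‖multExt g F ω‖ = 1 := by
  classical
  rw [multExt]
  induction normalizedFactors F using Multiset.induction with
  | empty => simp
  | cons P s ih => simp [hg, ih]

-- Allowing any larger index set lets two polynomials be written over the same primes.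
open Classical in
lemma multExt_eq_prod (g : K[X] → Ω → ℂ) (F : K[X]) (T : Finset K[X])
    (hT : (normalizedFactors F).toFinset ⊆ T) (ω : Ω) :
    multExt g F ω = ∏ P ∈ T, g P ω ^ (normalizedFactors F).count P := by
  rw [multExt, Finset.prod_multiset_map_count]
  refine Finset.prod_subset hT fun P _ hP => ?_
  rw [Multiset.count_eq_zero_of_notMem fun h => hP (Multiset.mem_toFinset.mpr h), pow_zero]

open Classical in
lemma Monic.prod_normalizedFactors {F : K[X]} (hF : F.Monic) : (normalizedFactors F).prod = F := by
  rw [prod_normalizedFactors_eq hF.ne_zero, hF.normalize_eq_self]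

variable [MeasurableSpace Ω]

/-- Measurable, unimodular values at the primes of a Steinhaus random multiplicative function. -/
structure IsPrimeSteinhaus (g : K[X] → Ω → ℂ) (μ : Measure Ω) : Prop where
  measurable : ∀ P, Measurable (g P)
  norm_eq_one : ∀ P ω, ‖g P ω‖ = 1
  map_eq : ∀ P : K[X], P.Monic → Irreducible P → μ.map (g P) = uniformUnitCircle
  indep : iIndepFun (fun P : {P : K[X] // P.Monic ∧ Irreducible P} => g P) μ

/-- A Steinhaus random multiplicative function agrees almost surely with the multiplicative
extension of measurable unimodular values at the primes. -/
lemma IsSteinhaus.exists_isPrimeSteinhaus {f : K[X] → Ω → ℂ} {μ : Measure Ω}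
    (hf : IsSteinhaus f μ) :
    ∃ g, IsPrimeSteinhaus g μ ∧ ∀ F : K[X], F.Monic → f F =ᵐ[μ] multExt g F := by
  classical
  -- A measurable version is reset to $1$ where its modulus is not $1$, a null set, so that
  -- measurability and unimodularity hold everywhere.
  set g : K[X] → Ω → ℂ := fun P => if h : P.Monic ∧ Irreducible P then
    fun ω => if ‖(hf.hasLaw P h.1 h.2).aemeasurable.mk (f P) ω‖ = 1
      then (hf.hasLaw P h.1 h.2).aemeasurable.mk (f P) ω else 1 else fun _ => 1 with hg
  have hfg : ∀ P, P.Monic → Irreducible P → f P =ᵐ[μ] g P := by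
    intro P h1 h2
    have hl := hf.hasLaw P h1 h2
    have hn : ∀ᵐ ω ∂μ, ‖f P ω‖ = 1 := by
      have := ae_norm_eq_one_uniformUnitCircle
      rw [← hl.map_eq] at this
      exact ae_of_ae_map hl.aemeasurable this
    filter_upwards [hn, hl.aemeasurable.ae_eq_mk] with ω h h'
    simp only [hg]
    rw [dif_pos ⟨h1, h2⟩]
    simp only [← h', h, if_true]
  refine ⟨g, ⟨?_, ?_, ?_, ?_⟩, ?_⟩
  · intro P
    by_cases h : P.Monic ∧ Irreducible P
    · simp only [hg, dif_pos h]
      have hm := (hf.hasLaw P h.1 h.2).aemeasurable.measurable_mk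
      exact Measurable.ite (measurableSet_eq_fun hm.norm measurable_const) hm measurable_const
    · simp only [hg, dif_neg h]
      exact measurable_const
  · intro P ω
    simp only [hg]
    split_ifs with h
    · simp only
      split_ifs with h'
      · exact h'
      · simp
    · simp
  · intro P h1 h2
    rw [← (hf.hasLaw P h1 h2).map_eq]
    exact (Measure.map_congr (hfg P h1 h2)).symm
  · exact hf.indep.congr fun P => hfg P P.2.1 P.2.2
  · intro F hF
    have hmem : ∀ P ∈ (normalizedFactors F).toFinset, P.Monic ∧ Irreducible P := fun P hP =>
      monic_irreducible_of_mem_normalizedFactors (Multiset.mem_toFinset.mp hP)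
    have hall : ∀ᵐ ω ∂μ, ∀ P ∈ (normalizedFactors F).toFinset, f P ω = g P ω :=
      (Finset.eventually_all _).mpr fun P hP => hfg P (hmem P hP).1 (hmem P hP).2
    filter_upwards [hall] with ω hω
    rw [multExt_eq_prod g F _ subset_rfl]
    have e := hf.map_prod_pow _ (fun P => (normalizedFactors F).count P) hmem ω
    have : ∏ P ∈ (normalizedFactors F).toFinset, P ^ (normalizedFactors F).count P = F := by
      rw [← Finset.prod_multiset_count, Monic.prod_normalizedFactors hF]
    rw [this] at e
    rw [e]
    exact Finset.prod_congr rfl fun P hP => by rw [hω P hP]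

variable {g : K[X] → Ω → ℂ} {μ : Measure Ω}

lemma IsPrimeSteinhaus.measurable_multExt (hg : IsPrimeSteinhaus g μ) (F : K[X]) :
    Measurable (multExt g F) :=
  _root_.measurable_multExt fun P _ _ _ => hg.measurable P

open Classical in
/-- Orthogonality of the values of a Steinhaus random multiplicative function. -/
lemma IsPrimeSteinhaus.integral_multExt_mul_conj (hg : IsPrimeSteinhaus g μ) {F H : K[X]}
    (hF : F.Monic) (hH : H.Monic) :
    ∫ ω, multExt g F ω * conj (multExt g H ω) ∂μ = if F = H then 1 else 0 := by
  set T := (normalizedFactors F).toFinset ∪ (normalizedFactors H).toFinset with hT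
  have hmem : ∀ P ∈ T, P.Monic ∧ Irreducible P := fun P hP => by
    rcases Finset.mem_union.mp hP with h | h <;>
      exact monic_irreducible_of_mem_normalizedFactors (Multiset.mem_toFinset.mp h)
  have hi : iIndepFun (fun P : T => g P) μ :=
    hg.indep.precomp (g := fun P : T => ⟨P.1, hmem P.1 P.2⟩) fun P Q h =>
      Subtype.ext (congrArg (fun R : {P : K[X] // P.Monic ∧ Irreducible P} => R.1) h)
  have e : ∀ ω, multExt g F ω * conj (multExt g H ω) = ∏ P : T,
      (fun (P : T) (u : ℂ) => u ^ (normalizedFactors F).count P.1 *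
        conj u ^ (normalizedFactors H).count P.1) P (g P ω) := fun ω => by
    rw [multExt_eq_prod g F T Finset.subset_union_left,
      multExt_eq_prod g H T Finset.subset_union_right, map_prod, ← Finset.prod_mul_distrib,
      ← Finset.prod_coe_sort]
    simp
  simp_rw [e]
  rw [hi.integral_fun_prod_comp (fun P => (hg.measurable P).aemeasurable)
    (fun P => (by fun_prop : Measurable fun u : ℂ => u ^ (normalizedFactors F).count P.1 *
        conj u ^ (normalizedFactors H).count P.1).aestronglyMeasurable)]
  have e2 : ∀ P : T, ∫ ω, g P ω ^ (normalizedFactors F).count P.1 *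
        conj (g P ω) ^ (normalizedFactors H).count P.1 ∂μ
      = if (normalizedFactors F).count P.1 = (normalizedFactors H).count P.1 then 1 else 0 := by
    intro P
    rw [← integral_pow_mul_conj_pow_uniformUnitCircle, ← hg.map_eq P (hmem P P.2).1 (hmem P P.2).2,
      integral_map (hg.measurable P).aemeasurable]
    exact (by fun_prop : Measurable fun u : ℂ => u ^ (normalizedFactors F).count P.1 *
        conj u ^ (normalizedFactors H).count P.1).aestronglyMeasurable
  simp only [e2]
  split_ifs with h
  · simp [h]
  -- By unique factorisation distinct monic polynomials differ in the exponent of some prime, and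
  -- that factor has mean zero.
  · have : ∃ P : T, (normalizedFactors F).count P.1 ≠ (normalizedFactors H).count P.1 := by
      by_contra! hc
      apply h
      rw [← Monic.prod_normalizedFactors hF, ← Monic.prod_normalizedFactors hH]
      congr 1
      ext P
      by_cases hP : P ∈ T
      · exact hc ⟨P, hP⟩
      · rw [hT, Finset.mem_union, Multiset.mem_toFinset, Multiset.mem_toFinset, not_or] at hP
        rw [Multiset.count_eq_zero_of_notMem hP.1, Multiset.count_eq_zero_of_notMem hP.2]
    obtain ⟨P, hP⟩ := this
    exact Finset.prod_eq_zero (Finset.mem_univ P) (if_neg hP)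

variable [IsProbabilityMeasure μ]

lemma IsPrimeSteinhaus.integrable_multExt_mul_conj (hg : IsPrimeSteinhaus g μ) (F H : K[X]) :
    Integrable (fun ω => multExt g F ω * conj (multExt g H ω)) μ := by
  refine Integrable.of_bound (C := 1) ?_ ?_
  · apply Measurable.aestronglyMeasurable
    exact (hg.measurable_multExt F).mul
      (RCLike.continuous_conj.measurable.comp (hg.measurable_multExt H))
  · filter_upwards with ω
    simp [norm_multExt hg.norm_eq_one]

/-- The second moment of a sum of values of a Steinhaus random multiplicative function. -/
lemma IsPrimeSteinhaus.integral_norm_sum_sq (hg : IsPrimeSteinhaus g μ) {B : Finset K[X]}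
    (hB : ∀ F ∈ B, F.Monic) :
    ∫ ω, ‖∑ F ∈ B, multExt g F ω‖ ^ 2 ∂μ = B.card := by
  classical
  have e : ∀ ω, ((‖∑ F ∈ B, multExt g F ω‖ ^ 2 : ℝ) : ℂ)
      = ∑ p ∈ B ×ˢ B, multExt g p.1 ω * conj (multExt g p.2 ω) := fun ω => by
    rw [Complex.ofReal_pow, ← Complex.mul_conj', map_sum, Finset.sum_mul_sum,
      Finset.sum_product]
  apply Complex.ofReal_injective
  rw [← integral_complex_ofReal]
  simp_rw [e]
  rw [integral_finsetSum _ fun p _ => hg.integrable_multExt_mul_conj _ _]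
  have : ∀ p ∈ B ×ˢ B, ∫ ω, multExt g p.1 ω * conj (multExt g p.2 ω) ∂μ
      = if p.1 = p.2 then 1 else 0 := fun p hp => by
    rw [Finset.mem_product] at hp
    exact hg.integral_multExt_mul_conj (hB _ hp.1) (hB _ hp.2)
  rw [Finset.sum_congr rfl this, Finset.sum_product]
  simp

open Classical in
/-- Mixed fourth moments of sums of values of a Steinhaus random multiplicative function count
multiplicative quadruples. -/
lemma IsPrimeSteinhaus.integral_norm_sum_sq_mul_norm_sum_sq (hg : IsPrimeSteinhaus g μ)
    {B C : Finset K[X]} (hB : ∀ F ∈ B, F.Monic) (hC : ∀ F ∈ C, F.Monic) :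
    ∫ ω, ‖∑ F ∈ B, multExt g F ω‖ ^ 2 * ‖∑ F ∈ C, multExt g F ω‖ ^ 2 ∂μ
      = Finset.mulEnergy B C := by
  have e : ∀ ω, ((‖∑ F ∈ B, multExt g F ω‖ ^ 2 * ‖∑ F ∈ C, multExt g F ω‖ ^ 2 : ℝ) : ℂ)
      = ∑ p ∈ (B ×ˢ B) ×ˢ C ×ˢ C,
        multExt g (p.1.1 * p.2.1) ω * conj (multExt g (p.1.2 * p.2.2) ω) := fun ω => by
    have e1 : ∀ B : Finset K[X], ((‖∑ F ∈ B, multExt g F ω‖ ^ 2 : ℝ) : ℂ)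
        = ∑ p ∈ B ×ˢ B, multExt g p.1 ω * conj (multExt g p.2 ω) := fun B => by
      rw [Complex.ofReal_pow, ← Complex.mul_conj', map_sum, Finset.sum_mul_sum,
        Finset.sum_product]
    rw [Complex.ofReal_mul, e1, e1, Finset.sum_mul_sum, Finset.sum_product (B ×ˢ B)]
    refine Finset.sum_congr rfl fun p hp => Finset.sum_congr rfl fun r hr => ?_
    rw [Finset.mem_product] at hp hr
    rw [multExt_mul g (hB _ hp.1).ne_zero (hC _ hr.1).ne_zero,
      multExt_mul g (hB _ hp.2).ne_zero (hC _ hr.2).ne_zero, map_mul]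
    ring
  apply Complex.ofReal_injective
  rw [← integral_complex_ofReal]
  simp_rw [e]
  rw [integral_finsetSum _ fun p _ => hg.integrable_multExt_mul_conj _ _]
  have : ∀ p ∈ (B ×ˢ B) ×ˢ C ×ˢ C,
      ∫ ω, multExt g (p.1.1 * p.2.1) ω * conj (multExt g (p.1.2 * p.2.2) ω) ∂μ
      = if p.1.1 * p.2.1 = p.1.2 * p.2.2 then 1 else 0 := fun p hp => by
    simp only [Finset.mem_product] at hp
    exact hg.integral_multExt_mul_conj ((hB _ hp.1.1).mul (hC _ hp.2.1))
      ((hB _ hp.1.2).mul (hC _ hp.2.2))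
  rw [Finset.sum_congr rfl this, Finset.sum_boole, Finset.mulEnergy]
  simp

end Steinhaus

/-! ### Trivial and nontrivial multiplicative quadruples. -/

section Energy

variable {α : Type*} [DecidableEq α]

/-- The trivial solutions `a * b = a * b`. -/
def parallelQuadruples (s t : Finset α) : Finset ((α × α) × α × α) :=
  (s ×ˢ t).image fun p => ((p.1, p.1), p.2, p.2)

/-- The trivial solutions `a * b = b * a`. -/
def crossedQuadruples (s : Finset α) : Finset ((α × α) × α × α) :=
  (s ×ˢ s).image fun p => ((p.1, p.2), p.2, p.1)

lemma card_parallelQuadruples (s t : Finset α) :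
    (parallelQuadruples s t).card = s.card * t.card := by
  rw [parallelQuadruples, Finset.card_image_of_injective, Finset.card_product]
  rintro ⟨a, b⟩ ⟨c, d⟩ h
  simp only [Prod.mk.injEq] at h ⊢
  tauto

lemma card_crossedQuadruples (s : Finset α) :
    (crossedQuadruples s).card = s.card * s.card := by
  rw [crossedQuadruples, Finset.card_image_of_injective, Finset.card_product]
  rintro ⟨a, b⟩ ⟨c, d⟩ h
  simp only [Prod.mk.injEq] at h ⊢
  tauto

variable [CommMonoid α]

/-- The quadruples counted by `Finset.mulEnergy s t` which are not trivial solutions. -/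
def nontrivialQuadruples (s t : Finset α) : Finset ((α × α) × α × α) :=
  ((s ×ˢ s) ×ˢ t ×ˢ t).filter fun p => p.1.1 * p.2.1 = p.1.2 * p.2.2 ∧
    ¬(p.1.1 = p.1.2 ∧ p.2.1 = p.2.2) ∧ ¬(p.1.1 = p.2.2 ∧ p.2.1 = p.1.2)

/-- A crossed solution has every entry in both sets, hence the intersection term; it disappears for
disjoint sets. -/
lemma mulEnergy_le_add_card_nontrivialQuadruples (s t : Finset α) :
    Finset.mulEnergy s t ≤ s.card * t.card + (s ∩ t).card * (s ∩ t).card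
      + (nontrivialQuadruples s t).card := by
  rw [← card_parallelQuadruples s t, ← card_crossedQuadruples (s ∩ t)]
  refine le_trans (Finset.card_le_card ?_) ((Finset.card_union_le _ _).trans
    (Nat.add_le_add_right (Finset.card_union_le _ _) _))
  rintro ⟨⟨a, b⟩, c, d⟩ h
  simp only [Finset.mem_filter, Finset.mem_product] at h
  obtain ⟨⟨⟨ha, hb⟩, hc, hd⟩, he⟩ := h
  simp only [Finset.mem_union, parallelQuadruples, crossedQuadruples, nontrivialQuadruples,
    Finset.mem_image, Finset.mem_filter, Finset.mem_product, Finset.mem_inter, Prod.exists,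
    Prod.mk.injEq]
  by_cases h1 : a = b ∧ c = d
  · exact Or.inl (Or.inl ⟨a, c, ⟨ha, hc⟩, ⟨rfl, h1.1⟩, rfl, h1.2⟩)
  by_cases h2 : a = d ∧ c = b
  · obtain ⟨rfl, rfl⟩ := h2
    exact Or.inl (Or.inr ⟨a, c, ⟨⟨ha, hd⟩, hb, hc⟩, ⟨rfl, rfl⟩, rfl, rfl⟩)
  exact Or.inr ⟨⟨⟨ha, hb⟩, hc, hd⟩, he, h1, h2⟩

/-- The two trivial families meet only in the diagonal quadruples $(a,a,a,a)$, which gives the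
correction `s.card`. Hence energy $(2+o(1))|\mathcal S|^2$ leaves few nontrivial quadruples. -/
lemma card_nontrivialQuadruples_add_le (s : Finset α) :
    (nontrivialQuadruples s s).card + 2 * s.card ^ 2 ≤ Finset.mulEnergy s s + s.card := by
  have h1 := Finset.card_union_add_card_inter (parallelQuadruples s s) (crossedQuadruples s)
  rw [card_parallelQuadruples, card_crossedQuadruples] at h1
  have h2 : (parallelQuadruples s s ∩ crossedQuadruples s).card ≤ s.card := by
    refine le_trans (Finset.card_le_card (t := s.image fun a => ((a, a), a, a)) ?_)
      Finset.card_image_le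
    rintro ⟨⟨a, b⟩, c, d⟩ h
    simp only [Finset.mem_inter, parallelQuadruples, crossedQuadruples, Finset.mem_image,
      Finset.mem_product, Prod.exists, Prod.mk.injEq] at h ⊢
    obtain ⟨⟨x, y, ⟨hx, hy⟩, ⟨rfl, rfl⟩, rfl, rfl⟩, u, v, -, ⟨rfl, rfl⟩, rfl, -⟩ := h
    exact ⟨_, hx, ⟨rfl, rfl⟩, rfl, rfl⟩
  have h3 : (nontrivialQuadruples s s ∪
      (parallelQuadruples s s ∪ crossedQuadruples s)).card ≤ Finset.mulEnergy s s := by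
    refine Finset.card_le_card ?_
    rintro ⟨⟨a, b⟩, c, d⟩ h
    simp only [Finset.mem_union, nontrivialQuadruples, parallelQuadruples, crossedQuadruples,
      Finset.mem_image, Finset.mem_filter, Finset.mem_product, Prod.exists, Prod.mk.injEq] at h ⊢
    rcases h with h | ⟨x, y, ⟨hx, hy⟩, ⟨rfl, rfl⟩, rfl, rfl⟩ | ⟨x, y, ⟨hx, hy⟩, ⟨rfl, rfl⟩, rfl, rfl⟩
    · exact ⟨h.1, h.2.1⟩
    · exact ⟨⟨⟨hx, hx⟩, hy, hy⟩, rfl⟩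
    · exact ⟨⟨⟨hx, hy⟩, hy, hx⟩, mul_comm _ _⟩
  rw [Finset.card_union_of_disjoint] at h3
  · nlinarith
  · rw [Finset.disjoint_left]
    rintro ⟨⟨a, b⟩, c, d⟩ h h'
    simp only [Finset.mem_union, nontrivialQuadruples, parallelQuadruples, crossedQuadruples,
      Finset.mem_image, Finset.mem_filter, Finset.mem_product, Prod.exists, Prod.mk.injEq] at h h'
    rcases h' with ⟨x, y, -, ⟨rfl, rfl⟩, rfl, rfl⟩ | ⟨x, y, -, ⟨rfl, rfl⟩, rfl, rfl⟩
    · exact h.2.2.1 ⟨rfl, rfl⟩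
    · exact h.2.2.2 ⟨rfl, rfl⟩

/-- The blocks are disjoint, so a quadruple determines the pair $(k,l)$ it comes from, and nothing
is counted twice. -/
lemma sum_card_nontrivialQuadruples_le {S : Finset α} {n : ℕ} {G : ℕ → Finset α}
    (hGS : ∀ k < n, G k ⊆ S) (hG : ∀ k l, k ≠ l → Disjoint (G k) (G l)) :
    ∑ k ∈ Finset.range n, ∑ l ∈ Finset.range n, (nontrivialQuadruples (G k) (G l)).card
      ≤ (nontrivialQuadruples S S).card := by
  rw [← Finset.sum_product', ← Finset.card_biUnion]
  · refine Finset.card_le_card fun p hp => ?_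
    simp only [Finset.mem_biUnion, Finset.mem_product, Finset.mem_range, nontrivialQuadruples,
      Finset.mem_filter] at hp ⊢
    obtain ⟨⟨k, l⟩, ⟨hk, hl⟩, ⟨⟨h1, h2⟩, h3, h4⟩, h5⟩ := hp
    exact ⟨⟨⟨hGS k hk h1, hGS k hk h2⟩, hGS l hl h3, hGS l hl h4⟩, h5⟩
  · rintro ⟨k, l⟩ - ⟨k', l'⟩ - hne
    refine Finset.disjoint_left.mpr fun p hp hp' => ?_
    simp only [nontrivialQuadruples, Finset.mem_filter, Finset.mem_product] at hp hp'
    apply hne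
    have h1 : k = k' := by
      by_contra h
      exact Finset.disjoint_left.mp (hG k k' h) hp.1.1.1 hp'.1.1.1
    have h2 : l = l' := by
      by_contra h
      exact Finset.disjoint_left.mp (hG l l' h) hp.1.2.1 hp'.1.2.1
    rw [h1, h2]

/-- Used for the second moment of the total conditional variance: the parallel solutions give the
square of its mean, and the crossed ones occur only for $k=l$. -/
lemma sum_sum_mulEnergy_le {S : Finset α} {n : ℕ} {G : ℕ → Finset α}
    (hGS : ∀ k < n, G k ⊆ S) (hG : ∀ k l, k ≠ l → Disjoint (G k) (G l)) :
    ∑ k ∈ Finset.range n, ∑ l ∈ Finset.range n, Finset.mulEnergy (G k) (G l)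
      ≤ (∑ k ∈ Finset.range n, (G k).card) ^ 2 + ∑ k ∈ Finset.range n, (G k).card ^ 2
        + (nontrivialQuadruples S S).card := by
  have h : ∀ k ∈ Finset.range n, ∑ l ∈ Finset.range n, Finset.mulEnergy (G k) (G l)
      ≤ ∑ l ∈ Finset.range n, (G k).card * (G l).card + (G k).card ^ 2 +
        ∑ l ∈ Finset.range n, (nontrivialQuadruples (G k) (G l)).card := fun k hk => by
    have e : (G k).card ^ 2 = ∑ l ∈ Finset.range n, (G k ∩ G l).card * (G k ∩ G l).card := by
      rw [Finset.sum_eq_single_of_mem k hk fun l _ hl => by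
        rw [Finset.disjoint_iff_inter_eq_empty.mp (hG k l hl.symm)]; simp]
      rw [Finset.inter_self, sq]
    rw [e, ← Finset.sum_add_distrib, ← Finset.sum_add_distrib]
    exact Finset.sum_le_sum fun l _ => mulEnergy_le_add_card_nontrivialQuadruples _ _
  refine (Finset.sum_le_sum h).trans ?_
  rw [Finset.sum_add_distrib, Finset.sum_add_distrib, sq, Finset.sum_mul_sum]
  exact Nat.add_le_add_left (sum_card_nontrivialQuadruples_le hGS hG) _

/-- Used for the fourth moments; for $k=l$ each trivial family contributes $|G_k|^2$. -/
lemma sum_mulEnergy_self_le {S : Finset α} {n : ℕ} {G : ℕ → Finset α}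
    (hGS : ∀ k < n, G k ⊆ S) (hG : ∀ k l, k ≠ l → Disjoint (G k) (G l)) :
    ∑ k ∈ Finset.range n, Finset.mulEnergy (G k) (G k)
      ≤ 2 * ∑ k ∈ Finset.range n, (G k).card ^ 2 + (nontrivialQuadruples S S).card := by
  have h : ∀ k ∈ Finset.range n, Finset.mulEnergy (G k) (G k)
      ≤ 2 * (G k).card ^ 2 +
        ∑ l ∈ Finset.range n, (nontrivialQuadruples (G k) (G l)).card := fun k hk => by
    have := mulEnergy_le_add_card_nontrivialQuadruples (G k) (G k)
    rw [Finset.inter_self] at this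
    have h2 := Finset.single_le_sum
      (f := fun l => (nontrivialQuadruples (G k) (G l)).card) (fun _ _ => Nat.zero_le _) hk
    nlinarith
  refine (Finset.sum_le_sum h).trans ?_
  rw [Finset.sum_add_distrib, ← Finset.mul_sum]
  exact Nat.add_le_add_left (sum_card_nontrivialQuadruples_le hGS hG) _

end Energy

/-! ### Smooth polynomials, multiples and large square factors over a finite field. -/

section Counting

open UniqueFactorizationMonoid

variable {K : Type*} [Field K]

lemma isCoprime_of_monic_irreducible {P Q : K[X]} (hP : P.Monic) (hPi : Irreducible P)
    (hQ : Q.Monic) (hQi : Irreducible Q) (hne : P ≠ Q) : IsCoprime P Q := by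
  rw [hPi.coprime_iff_not_dvd]
  exact fun h => hne (eq_of_monic_of_associated hP hQ (hPi.associated_of_dvd hQi h))

open Classical in
/-- Rankin's bound for the number of polynomials all of whose prime factors lie in `Q`. -/
lemma card_mul_pow_le_prod_of_factors_mem {A Q : Finset K[X]} {N : ℕ}
    (hA : ∀ F ∈ A, F.Monic ∧ F.natDegree = N) (hQ : ∀ P ∈ Q, P.Monic ∧ Irreducible P)
    (hAQ : ∀ F ∈ A, ∀ P : K[X], P.Monic → Irreducible P → P ∣ F → P ∈ Q)
    {z : ℝ} (hz : 0 ≤ z) (hz1 : ∀ P ∈ Q, z ^ P.natDegree < 1) :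
    A.card * z ^ N ≤ ∏ P ∈ Q, (1 - z ^ P.natDegree)⁻¹ := by
  have hsub : ∀ F ∈ A, (normalizedFactors F).toFinset ⊆ Q := fun F hF P hP => by
    rw [Multiset.mem_toFinset] at hP
    obtain ⟨h1, h2⟩ := monic_irreducible_of_mem_normalizedFactors hP
    exact hAQ F hF P h1 h2 (dvd_of_mem_normalizedFactors hP)
  have hprod : ∀ F ∈ A, ∏ P ∈ Q, P ^ (normalizedFactors F).count P = F := fun F hF => by
    rw [← Finset.prod_multiset_count_of_subset _ _ (hsub F hF),
      Monic.prod_normalizedFactors (hA F hF).1]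
  have hdeg : ∀ F ∈ A, ∑ P ∈ Q, (normalizedFactors F).count P * P.natDegree = N := fun F hF => by
    have := congrArg natDegree (hprod F hF)
    rw [natDegree_prod_of_monic _ _ fun P hP => (hQ P hP).1.pow _, (hA F hF).2] at this
    simpa only [natDegree_pow] using this
  have hgeo : ∀ P ∈ Q, ∑ a ∈ Finset.range (N + 1), (z ^ P.natDegree) ^ a
      ≤ (1 - z ^ P.natDegree)⁻¹ := fun P hP =>
    (Summable.sum_le_tsum _ (fun _ _ => by positivity)
      (summable_geometric_of_lt_one (by positivity) (hz1 P hP))).trans_eq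
      (tsum_geometric_of_lt_one (by positivity) (hz1 P hP))
  refine le_trans ?_ (Finset.prod_le_prod (fun P _ => Finset.sum_nonneg fun _ _ => by positivity)
    hgeo)
  rw [← Finset.prod_coe_sort Q fun P => ∑ a ∈ Finset.range (N + 1), (z ^ P.natDegree) ^ a,
    Finset.prod_univ_sum]
  -- Unique factorisation embeds `A` into the exponent vectors occurring when the truncated Euler
  -- product is expanded; exponents stay at most $N$ because each prime has degree at least $1$.
  set e : K[X] → (Q → ℕ) := fun F P => (normalizedFactors F).count P.1 with he
  have hinj : Set.InjOn e A := fun F hF H hH h => by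
    rw [← hprod F hF, ← hprod H hH]
    refine Finset.prod_congr rfl fun P hP => ?_
    exact congrArg (P ^ ·) (congrFun h ⟨P, hP⟩)
  have hval : ∀ F ∈ A, z ^ N = ∏ P : Q, (z ^ P.1.natDegree) ^ e F P := fun F hF => by
    rw [Finset.prod_coe_sort Q fun P => (z ^ P.natDegree) ^ (normalizedFactors F).count P]
    simp_rw [← pow_mul]
    rw [Finset.prod_pow_eq_pow_sum, ← hdeg F hF]
    congr 1
    exact Finset.sum_congr rfl fun P _ => mul_comm _ _
  rw [← nsmul_eq_mul, ← Finset.sum_const, Finset.sum_congr rfl hval,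
    ← Finset.sum_image (f := fun x : Q → ℕ => ∏ P : Q, (z ^ P.1.natDegree) ^ x P) hinj]
  refine Finset.sum_le_sum_of_subset_of_nonneg ?_ fun _ _ _ =>
    Finset.prod_nonneg fun _ _ => by positivity
  intro x hx
  obtain ⟨F, hF, rfl⟩ := Finset.mem_image.mp hx
  rw [Fintype.mem_piFinset]
  intro P
  rw [Finset.mem_range, Nat.lt_succ_iff]
  have h1 := Finset.single_le_sum (f := fun P => (normalizedFactors F).count P * P.natDegree)
    (fun _ _ => Nat.zero_le _) P.2
  rw [hdeg F hF] at h1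
  exact (Nat.le_mul_of_pos_right _ (hQ P.1 P.2).2.natDegree_pos).trans h1

variable [Fintype K]

open Classical in
variable (K) in
/-- The monic polynomials of degree `n` over a finite field. -/
noncomputable def monicsOfDegree (n : ℕ) : Finset K[X] :=
  Finset.univ.image fun v : Fin n → K => X ^ n + ∑ i : Fin n, C (v i) * X ^ (i : ℕ)

lemma mem_monicsOfDegree {F : K[X]} (hF : F.Monic) : F ∈ monicsOfDegree K F.natDegree := by
  classical
  rw [monicsOfDegree, Finset.mem_image]
  refine ⟨fun i => F.coeff i, Finset.mem_univ _, ?_⟩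
  conv_rhs => rw [hF.as_sum]
  rw [Finset.sum_range]

lemma card_monicsOfDegree_le (n : ℕ) : (monicsOfDegree K n).card ≤ Fintype.card K ^ n := by
  classical
  refine Finset.card_image_le.trans ?_
  simp

/-- The cofactor of $P$ is monic of degree $N-\deg P$. This supplies both the bound for multiples of
a large prime and that for multiples of its square. -/
lemma card_multiples_mul_le {A : Finset K[X]} {N : ℕ} (hA : ∀ F ∈ A, F.Monic ∧ F.natDegree = N)
    {P : K[X]} (hP : P.Monic) (hPA : ∀ F ∈ A, P ∣ F) :
    A.card * Fintype.card K ^ P.natDegree ≤ Fintype.card K ^ N := by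
  classical
  rcases A.eq_empty_or_nonempty with rfl | ⟨F₀, h₀⟩
  · simp
  have hle : P.natDegree ≤ N := by
    rw [← (hA F₀ h₀).2]
    exact natDegree_le_of_dvd (hPA F₀ h₀) (hA F₀ h₀).1.ne_zero
  have hsub : A ⊆ (monicsOfDegree K (N - P.natDegree)).image fun H => P * H := by
    intro F hF
    obtain ⟨H, rfl⟩ := hPA F hF
    obtain ⟨h1, h2⟩ := hA _ hF
    have hH : H.Monic := hP.of_mul_monic_left h1
    rw [hP.natDegree_mul hH] at h2
    refine Finset.mem_image.mpr ⟨H, ?_, rfl⟩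
    rw [← h2, Nat.add_sub_cancel_left]
    exact mem_monicsOfDegree hH
  calc A.card * Fintype.card K ^ P.natDegree
      ≤ Fintype.card K ^ (N - P.natDegree) * Fintype.card K ^ P.natDegree :=
        Nat.mul_le_mul_right _ ((Finset.card_le_card hsub).trans
          (Finset.card_image_le.trans (card_monicsOfDegree_le _)))
    _ = Fintype.card K ^ N := by rw [← pow_add, Nat.sub_add_cancel hle]

/-- There are at most `q ^ d / d` monic irreducible polynomials of degree `d` over `𝔽_q`. -/
lemma card_mul_le_of_irreducible {Q : Finset K[X]} {d : ℕ} (hd : d ≠ 0)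
    (hQ : ∀ P ∈ Q, P.Monic ∧ Irreducible P) (hdeg : ∀ P ∈ Q, P.natDegree = d) :
    Q.card * d ≤ Fintype.card K ^ d := by
  -- Distinct monic irreducibles of degree $d$ are coprime divisors of $X^{q^d}-X$; degrees are then
  -- compared.
  have hdvd : ∏ P ∈ Q, P ∣ (X ^ Fintype.card K ^ d - X : K[X]) := by
    refine Finset.prod_dvd_of_coprime (s := fun P => P) (fun P hP R hR hne =>
      isCoprime_of_monic_irreducible (hQ P hP).1 (hQ P hP).2 (hQ R hR).1 (hQ R hR).2 hne) ?_
    intro P hP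
    rw [← Nat.card_eq_fintype_card]
    exact ((hQ P hP).2.natDegree_dvd_iff_dvd_X_pow_card_pow_sub_X).mp (by rw [hdeg P hP])
  have hq : 1 < Fintype.card K := Fintype.one_lt_card
  have := natDegree_le_of_dvd hdvd (FiniteField.X_pow_card_pow_sub_X_ne_zero K hd hq)
  rw [FiniteField.X_pow_card_pow_sub_X_natDegree_eq K hd hq,
    natDegree_prod_of_monic _ _ fun P hP => (hQ P hP).1, Finset.sum_congr rfl hdeg] at this
  simpa using this

/-- An upper bound of Mertens type for sums over monic irreducible polynomials. -/
lemma sum_inv_card_pow_natDegree_le {Q : Finset K[X]} {m : ℕ}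
    (hQ : ∀ P ∈ Q, P.Monic ∧ Irreducible P) (hdeg : ∀ P ∈ Q, P.natDegree ≤ m) :
    ∑ P ∈ Q, ((Fintype.card K : ℝ) ^ P.natDegree)⁻¹ ≤ 1 + Real.log m := by
  classical
  have hq : (0 : ℝ) < Fintype.card K := by exact_mod_cast Fintype.card_pos
  have hmaps : ∀ P ∈ Q, P.natDegree ∈ Finset.Icc 1 m := fun P hP =>
    Finset.mem_Icc.mpr ⟨(hQ P hP).2.natDegree_pos, hdeg P hP⟩
  rw [← Finset.sum_fiberwise_of_maps_to hmaps]
  refine le_trans ?_ (harmonic_le_one_add_log m)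
  rw [harmonic_eq_sum_Icc]
  push_cast
  -- Each degree $d$ contributes at most $1/d$, so a harmonic sum remains.
  refine Finset.sum_le_sum fun d hd => ?_
  have hd0 : d ≠ 0 := by have := (Finset.mem_Icc.mp hd).1; omega
  have hd1 : (0 : ℝ) < d := by exact_mod_cast Nat.pos_of_ne_zero hd0
  have hcard := card_mul_le_of_irreducible (Q := Q.filter fun P => P.natDegree = d) hd0
    (fun P hP => hQ P (Finset.mem_filter.mp hP).1) (fun P hP => (Finset.mem_filter.mp hP).2)
  rw [Finset.sum_congr rfl (g := fun _ => ((Fintype.card K : ℝ) ^ d)⁻¹) fun P hP => by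
    rw [(Finset.mem_filter.mp hP).2], Finset.sum_const, nsmul_eq_mul,
    ← div_eq_mul_inv, div_le_iff₀ (by positivity), inv_mul_eq_div, le_div_iff₀ hd1]
  exact_mod_cast hcard

/-- Few polynomials of degree `N` have only prime factors of norm at most
`exp (√(N log q) / 2)`. -/
lemma card_smooth_le {A Q : Finset K[X]} {N : ℕ} (hN : 1 ≤ N)
    (hA : ∀ F ∈ A, F.Monic ∧ F.natDegree = N) (hQ : ∀ P ∈ Q, P.Monic ∧ Irreducible P)
    (hAQ : ∀ F ∈ A, ∀ P : K[X], P.Monic → Irreducible P → P ∣ F → P ∈ Q)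
    (hQd : ∀ P ∈ Q, P.natDegree * Real.log (Fintype.card K)
      ≤ Real.sqrt (N * Real.log (Fintype.card K)) / 2) {m : ℕ} (hm : ∀ P ∈ Q, P.natDegree ≤ m) :
    (A.card : ℝ) ≤ (Fintype.card K : ℝ) ^ N *
      Real.exp (-(1 / 2) * Real.sqrt (N * Real.log (Fintype.card K))) *
        Real.exp (4 * (1 + Real.log m)) := by
  classical
  set q : ℝ := ((Fintype.card K : ℕ) : ℝ) with hq
  have hq2 : (2 : ℝ) ≤ q := by
    rw [hq]; exact_mod_cast (Fintype.one_lt_card : 1 < Fintype.card K)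
  have hq0 : 0 < q := by linarith
  have hlog : 0 < Real.log q := Real.log_pos (by linarith)
  have hN0 : (0 : ℝ) < N := by exact_mod_cast hN
  set L := N * Real.log q with hL
  have hL0 : 0 < L := by positivity
  have hs0 : 0 < Real.sqrt L := Real.sqrt_pos.mpr hL0
  have hss : Real.sqrt L * Real.sqrt L = L := Real.mul_self_sqrt hL0.le
  -- Rankin's parameter: $N\beta=\sqrt L/2$ is the saving, while $\beta\deg P\le 1/4$ for every
  -- $P\in Q$, so twisting by $e^{\beta\deg P}$ costs a factor at most $e^{1/4}\le 4/3$.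
  set β := Real.log q / (2 * Real.sqrt L) with hβ
  set z := q⁻¹ * Real.exp β with hz
  have hzpow : ∀ d : ℕ, z ^ d = (q ^ d)⁻¹ * Real.exp (d * β) := fun d => by
    rw [hz, mul_pow, inv_pow, ← Real.exp_nat_mul]
  have hzN : z ^ N = (q ^ N)⁻¹ * Real.exp (Real.sqrt L / 2) := by
    rw [hzpow]
    congr 2
    rw [hβ, mul_div_assoc', ← hL, div_eq_div_iff (by positivity) (by norm_num)]
    linear_combination -2 * hss
  have hexp : Real.exp (1 / 4) ≤ 4 / 3 := by
    have h1 : Real.exp (1 / 4) ^ 4 ≤ (4 / 3 : ℝ) ^ 4 := by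
      rw [← Real.exp_nat_mul]
      norm_num
      linarith [Real.exp_one_lt_d9]
    exact le_of_pow_le_pow_left₀ (by norm_num) (by norm_num) h1
  have hzP : ∀ P ∈ Q, z ^ P.natDegree ≤ 4 / 3 * (q ^ P.natDegree)⁻¹ := fun P hP => by
    rw [hzpow, mul_comm]
    refine mul_le_mul_of_nonneg_right ((Real.exp_le_exp.mpr ?_).trans hexp) (by positivity)
    rw [hβ, mul_div_assoc', div_le_iff₀ (by positivity)]
    linarith [hQd P hP]
  have hz23 : ∀ P ∈ Q, z ^ P.natDegree ≤ 2 / 3 := fun P hP => by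
    refine (hzP P hP).trans ?_
    have h2 : (2 : ℝ) ≤ q ^ P.natDegree :=
      hq2.trans (le_self_pow₀ (by linarith) (hQ P hP).2.natDegree_pos.ne')
    have : (q ^ P.natDegree)⁻¹ ≤ 2⁻¹ := inv_anti₀ (by norm_num) h2
    linarith
  have hz0 : 0 ≤ z := by positivity
  have h1 := card_mul_pow_le_prod_of_factors_mem hA hQ hAQ hz0
    fun P hP => (hz23 P hP).trans_lt (by norm_num)
  have h2 : ∏ P ∈ Q, (1 - z ^ P.natDegree)⁻¹ ≤ Real.exp (4 * (1 + Real.log m)) := by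
    calc ∏ P ∈ Q, (1 - z ^ P.natDegree)⁻¹
        ≤ ∏ P ∈ Q, Real.exp (4 * (q ^ P.natDegree)⁻¹) := by
          refine Finset.prod_le_prod (fun P hP => inv_nonneg.mpr (by linarith [hz23 P hP]))
            fun P hP => ?_
          have hy := hz23 P hP
          have hy0 : 0 ≤ z ^ P.natDegree := by positivity
          -- Valid because $y=z^{\deg P}\le 2/3$. The factor $4$ in the exponent is $3\cdot\frac43$.
          have h3 : (1 - z ^ P.natDegree)⁻¹ ≤ 3 * z ^ P.natDegree + 1 := by
            rw [inv_le_iff_one_le_mul₀ (by linarith)]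
            nlinarith
          refine h3.trans ((Real.add_one_le_exp _).trans (Real.exp_le_exp.mpr ?_))
          linarith [hzP P hP]
      _ = Real.exp (4 * ∑ P ∈ Q, (q ^ P.natDegree)⁻¹) := by
          rw [← Real.exp_sum, Finset.mul_sum]
      _ ≤ _ := by
          refine Real.exp_le_exp.mpr (mul_le_mul_of_nonneg_left ?_ (by norm_num))
          exact sum_inv_card_pow_natDegree_le hQ hm
  have h3 := h1.trans h2
  rw [hzN] at h3
  have h4 : Real.exp (-(1 / 2) * Real.sqrt L) * Real.exp (Real.sqrt L / 2) = 1 := by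
    rw [← Real.exp_add]; ring_nf; exact Real.exp_zero
  have h5 : (A.card : ℝ) = (A.card * ((q ^ N)⁻¹ * Real.exp (Real.sqrt L / 2))) *
      (q ^ N * Real.exp (-(1 / 2) * Real.sqrt L)) := by
    have : (q ^ N)⁻¹ * q ^ N = 1 := inv_mul_cancel₀ (by positivity)
    linear_combination (-(A.card : ℝ)) * h4 - A.card * (Real.exp (-(1 / 2) * Real.sqrt L) *
      Real.exp (Real.sqrt L / 2)) * this
  rw [h5, mul_comm]
  exact mul_le_mul_of_nonneg_left h3 (by positivity)

/-- Few polynomials of degree `N` are divisible by the square of a large irreducible. -/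
lemma card_sq_dvd_le {A T : Finset K[X]} {N : ℕ} {y : ℝ} (hy : 0 < y)
    (hA : ∀ F ∈ A, F.Monic ∧ F.natDegree = N) (hT : ∀ P ∈ T, P.Monic ∧ Irreducible P)
    (hTN : ∀ P ∈ T, P.natDegree ≤ N) (hTy : ∀ P ∈ T, y ≤ (Fintype.card K : ℝ) ^ P.natDegree)
    (hAT : ∀ F ∈ A, ∃ P ∈ T, P ^ 2 ∣ F) :
    (A.card : ℝ) ≤ (Fintype.card K : ℝ) ^ N * y⁻¹ * (1 + Real.log N) := by
  classical
  set q : ℝ := ((Fintype.card K : ℕ) : ℝ) with hq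
  have hq0 : 0 < q := by rw [hq]; exact_mod_cast Fintype.card_pos
  have hsub : A ⊆ T.biUnion fun P => A.filter fun F => P ^ 2 ∣ F := fun F hF => by
    obtain ⟨P, hP, h⟩ := hAT F hF
    exact Finset.mem_biUnion.mpr ⟨P, hP, Finset.mem_filter.mpr ⟨hF, h⟩⟩
  have h1 : (A.card : ℝ) ≤ ∑ P ∈ T, ((A.filter fun F => P ^ 2 ∣ F).card : ℝ) := by
    exact_mod_cast (Finset.card_le_card hsub).trans Finset.card_biUnion_le
  refine h1.trans ?_
  calc ∑ P ∈ T, ((A.filter fun F => P ^ 2 ∣ F).card : ℝ)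
      ≤ ∑ P ∈ T, q ^ N * y⁻¹ * (q ^ P.natDegree)⁻¹ := by
        refine Finset.sum_le_sum fun P hP => ?_
        have h2 := card_multiples_mul_le (A := A.filter fun F => P ^ 2 ∣ F) (N := N)
          (fun F hF => hA F (Finset.mem_filter.mp hF).1) ((hT P hP).1.pow 2)
          (fun F hF => (Finset.mem_filter.mp hF).2)
        rw [natDegree_pow] at h2
        have h3 : ((A.filter fun F => P ^ 2 ∣ F).card : ℝ) *
            (q ^ P.natDegree * q ^ P.natDegree) ≤ q ^ N := by
          rw [← pow_add, ← two_mul, hq]; exact_mod_cast h2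
        have hd : 0 < q ^ P.natDegree := by positivity
        -- One factor of $q^{-2\deg P}$ is bounded by $y^{-1}$; the other is kept for the Mertens
        -- sum.
        rw [← div_eq_mul_inv, ← div_eq_mul_inv, le_div_iff₀ hd, le_div_iff₀ hy]
        refine le_trans ?_ h3
        rw [mul_assoc]
        exact mul_le_mul_of_nonneg_left (mul_le_mul_of_nonneg_left (hTy P hP) hd.le)
          (Nat.cast_nonneg _)
    _ ≤ _ := by
        rw [← Finset.mul_sum]
        exact mul_le_mul_of_nonneg_left (sum_inv_card_pow_natDegree_le hT hTN) (by positivity)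

end Counting

/-! ### Comparison of characteristic functions and the filtration by primes. -/

section CharFunBound

open ComplexConjugate

lemma integral_le_sqrt_integral_sq {Ω : Type*} [MeasurableSpace Ω] {μ : Measure Ω}
    [IsProbabilityMeasure μ] {h : Ω → ℝ} (h1 : Integrable h μ)
    (h2 : Integrable (fun ω => h ω ^ 2) μ) :
    ∫ ω, h ω ∂μ ≤ Real.sqrt (∫ ω, h ω ^ 2 ∂μ) := by
  refine Real.le_sqrt_of_sq_le ?_
  set c := ∫ ω, h ω ∂μ with hc
  -- Nonnegativity of the variance of $h$.
  have h3 : 0 ≤ ∫ ω, (h ω ^ 2 - (2 * c) * h ω + c ^ 2) ∂μ :=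
    integral_nonneg fun ω => by
      change 0 ≤ h ω ^ 2 - (2 * c) * h ω + c ^ 2
      nlinarith [sq_nonneg (h ω - c)]
  rw [integral_add (show Integrable (fun ω => h ω ^ 2 - (2 * c) * h ω) μ from
      h2.sub (h1.const_mul _)) (integrable_const _),
    integral_sub h2 (h1.const_mul _), integral_const_mul, ← hc] at h3
  simp only [integral_const, probReal_univ, one_smul] at h3
  linarith

lemma norm_exp_mul_I_sub_exp_mul_I_le (x y : ℝ) :
    ‖Complex.exp (x * Complex.I) - Complex.exp (y * Complex.I)‖ ≤ |x - y| := by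
  have e : Complex.exp (x * Complex.I) - Complex.exp (y * Complex.I)
      = Complex.exp (y * Complex.I) * (Complex.exp (Complex.I * (x - y : ℝ)) - 1) := by
    rw [mul_sub, ← Complex.exp_add, mul_one]
    congr 2
    push_cast
    ring
  rw [e, norm_mul, Complex.norm_exp_ofReal_mul_I, one_mul]
  exact Real.norm_exp_I_mul_ofReal_sub_one_le

/-- Characteristic functions of `L²`-close variables are close. -/
lemma norm_integral_exp_sub_integral_exp_le {Ω : Type*} [MeasurableSpace Ω] {μ : Measure Ω}
    [IsProbabilityMeasure μ] {X Y : Ω → ℂ} (hX : Measurable X) (hY : Measurable Y) {B : ℝ}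
    (hB : ∀ ω, ‖X ω - Y ω‖ ≤ B) (t : ℂ) :
    ‖∫ ω, Complex.exp (((X ω * conj t).re : ℝ) * Complex.I) ∂μ
        - ∫ ω, Complex.exp (((Y ω * conj t).re : ℝ) * Complex.I) ∂μ‖
      ≤ ‖t‖ * Real.sqrt (∫ ω, ‖X ω - Y ω‖ ^ 2 ∂μ) := by
  have hexpint : ∀ Z : Ω → ℂ, Measurable Z →
      Integrable (fun ω => Complex.exp (((Z ω * conj t).re : ℝ) * Complex.I)) μ := fun Z hZ => by
    refine Integrable.of_bound (C := 1)
      (by apply Measurable.aestronglyMeasurable; fun_prop) ?_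
    filter_upwards with ω
    rw [Complex.norm_exp_ofReal_mul_I]
  have h1 : Integrable (fun ω => ‖X ω - Y ω‖) μ := by
    refine Integrable.of_bound (C := B) (hX.sub hY).norm.aestronglyMeasurable ?_
    filter_upwards with ω
    rw [norm_norm]
    exact hB ω
  have h2 : Integrable (fun ω => ‖X ω - Y ω‖ ^ 2) μ := by
    refine Integrable.of_bound (C := B ^ 2)
      ((hX.sub hY).norm.pow_const 2).aestronglyMeasurable ?_
    filter_upwards with ω
    rw [norm_pow, norm_norm]
    have := hB ω
    gcongr
  rw [← integral_sub (hexpint X hX) (hexpint Y hY)]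
  refine le_trans ?_ (mul_le_mul_of_nonneg_left (integral_le_sqrt_integral_sq h1 h2)
    (norm_nonneg t))
  rw [← integral_const_mul]
  refine norm_integral_le_of_norm_le (h1.const_mul _) ?_
  filter_upwards with ω
  refine (norm_exp_mul_I_sub_exp_mul_I_le _ _).trans ?_
  rw [← Complex.sub_re, ← sub_mul]
  refine (Complex.abs_re_le_norm _).trans ?_
  rw [norm_mul, RCLike.norm_conj, mul_comm]

/-- Only some enumeration of the large primes is needed; the martingale argument does not depend on
their order. -/
lemma exists_bijOn_Iio_card {α : Type*} [Inhabited α] (T : Finset α) :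
    ∃ p : ℕ → α, Set.BijOn p (Set.Iio T.card) T := by
  classical
  refine ⟨fun k => if h : k < T.card then (T.equivFin.symm ⟨k, h⟩ : T) else default, ?_, ?_, ?_⟩
  · intro k hk
    simp only [dif_pos (Set.mem_Iio.mp hk)]
    exact (T.equivFin.symm _).2
  · intro k hk l hl h
    simp only [dif_pos (Set.mem_Iio.mp hk), dif_pos (Set.mem_Iio.mp hl)] at h
    simpa using T.equivFin.symm.injective (Subtype.ext h)
  · intro x hx
    refine ⟨T.equivFin ⟨x, hx⟩, (T.equivFin ⟨x, hx⟩).2, ?_⟩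
    simp

variable {K Ω : Type*} [Field K] {g : K[X] → Ω → ℂ}

/-- The σ-algebra generated by the values of `g` at all primes except `p j` with `k ≤ j < n`. -/
noncomputable abbrev primeFiltration (g : K[X] → Ω → ℂ) (p : ℕ → K[X]) (n k : ℕ) : MeasurableSpace Ω :=
  ⨆ P ∈ {P : {P : K[X] // P.Monic ∧ Irreducible P} | ∀ j < n, k ≤ j → P.1 ≠ p j},
    MeasurableSpace.comap (g P.1) inferInstance

lemma primeFiltration_mono (p : ℕ → K[X]) (n : ℕ) : Monotone (primeFiltration g p n) :=
  fun _ _ hkl => biSup_mono fun _ hP j hj hl => hP j hj (hkl.trans hl)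

lemma measurable_primeFiltration {p : ℕ → K[X]} {n k : ℕ} {P : K[X]} (h1 : P.Monic)
    (h2 : Irreducible P) (h : ∀ j < n, k ≤ j → P ≠ p j) :
    Measurable[primeFiltration g p n k] (g P) := by
  refine Measurable.mono (comap_measurable (g P)) ?_ le_rfl
  exact le_iSup₂ (f := fun (P : {P : K[X] // P.Monic ∧ Irreducible P})
    (_ : P ∈ {P : {P : K[X] // P.Monic ∧ Irreducible P} | ∀ j < n, k ≤ j → P.1 ≠ p j}) =>
      MeasurableSpace.comap (g P.1) inferInstance) ⟨P, h1, h2⟩ h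

variable [MeasurableSpace Ω] {μ : Measure Ω}

lemma primeFiltration_le (hg : ∀ P, Measurable (g P)) (p : ℕ → K[X]) (n k : ℕ) :
    primeFiltration g p n k ≤ (inferInstance : MeasurableSpace Ω) :=
  iSup₂_le fun P _ => (hg P.1).comap_le

/-- The generators of the σ-algebra at stage $k$ omit $p_k$, so the two index sets of primes are
disjoint. -/
lemma IsPrimeSteinhaus.indep_primeFiltration (hg : IsPrimeSteinhaus g μ) {p : ℕ → K[X]} {n k : ℕ}
    (hk : k < n) (hp : (p k).Monic ∧ Irreducible (p k)) :
    Indep (primeFiltration g p n k) (MeasurableSpace.comap (g (p k)) inferInstance) μ := by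
  have h := indep_iSup_of_disjoint
    (m := fun P : {P : K[X] // P.Monic ∧ Irreducible P} =>
      MeasurableSpace.comap (g P.1) inferInstance)
    (fun P => (hg.measurable P.1).comap_le) hg.indep
    (S := {P | ∀ j < n, k ≤ j → P.1 ≠ p j}) (T := {⟨p k, hp⟩}) (by
      rw [Set.disjoint_singleton_right]
      exact fun h => h k hk le_rfl rfl)
  rwa [iSup_singleton] at h

end CharFunBound

/-! ### The martingale decomposition and the explicit bound for the characteristic function. -/

section CharFunBound

open ComplexConjugate

variable {K Ω : Type*} [Field K] {g : K[X] → Ω → ℂ}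

open Classical in
/-- The members of `S` that are divisible by `p k`, by no other `p j` with `k < j < n`, and by
the square of no `p j`. -/
noncomputable def topPrimeClass (S : Finset K[X]) (p : ℕ → K[X]) (n k : ℕ) : Finset K[X] :=
  S.filter fun F => k < n ∧ p k ∣ F ∧ (∀ j < n, p j ∣ F → j ≤ k) ∧ ∀ j < n, ¬ p j ^ 2 ∣ F

lemma topPrimeClass_subset (S : Finset K[X]) (p : ℕ → K[X]) (n k : ℕ) :
    topPrimeClass S p n k ⊆ S := by
  classical
  exact Finset.filter_subset _ _

lemma disjoint_topPrimeClass (S : Finset K[X]) (p : ℕ → K[X]) (n : ℕ) (k l : ℕ) (hkl : k ≠ l) :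
    Disjoint (topPrimeClass S p n k) (topPrimeClass S p n l) := by
  rw [Finset.disjoint_left]
  intro F hF hF'
  simp only [topPrimeClass, Finset.mem_filter] at hF hF'
  exact hkl (le_antisymm (hF'.2.2.2.1 k hF.2.1 hF.2.2.1) (hF.2.2.2.1 l hF'.2.1 hF'.2.2.1))

open Classical in
lemma biUnion_topPrimeClass (S : Finset K[X]) (p : ℕ → K[X]) (n : ℕ) :
    (Finset.range n).biUnion (topPrimeClass S p n)
      = S.filter fun F => (∃ j < n, p j ∣ F) ∧ ∀ j < n, ¬ p j ^ 2 ∣ F := by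
  ext F
  simp only [topPrimeClass, Finset.mem_biUnion, Finset.mem_filter, Finset.mem_range]
  constructor
  · rintro ⟨k, hk, hF, -, h1, -, h2⟩
    exact ⟨hF, ⟨k, hk, h1⟩, h2⟩
  · rintro ⟨hF, ⟨j, hj, hjF⟩, h2⟩
    obtain ⟨k, hk, hmax⟩ := Finset.exists_max_image
      ((Finset.range n).filter fun j => p j ∣ F) id ⟨j, by simp [hj, hjF]⟩
    rw [Finset.mem_filter, Finset.mem_range] at hk
    exact ⟨k, hk.1, hF, hk.1, hk.2, fun j hj hjF => hmax j (by simp [hj, hjF]), h2⟩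

/-- The predictable factor of the martingale difference attached to the prime `p k`. -/
noncomputable def predictableFactor (g : K[X] → Ω → ℂ) (S : Finset K[X]) (p : ℕ → K[X])
    (n k : ℕ) (r : ℝ) (ω : Ω) : ℂ :=
  (r : ℂ) * ∑ F ∈ topPrimeClass S p n k, multExt g (F / p k) ω

lemma mul_predictableFactor {S : Finset K[X]} (hS : ∀ F ∈ S, F.Monic) {p : ℕ → K[X]} {n k : ℕ}
    (hp : (p k).Monic ∧ Irreducible (p k)) (r : ℝ) (ω : Ω) :
    g (p k) ω * predictableFactor g S p n k r ω
      = (r : ℂ) * ∑ F ∈ topPrimeClass S p n k, multExt g F ω := by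
  rw [predictableFactor, mul_left_comm, Finset.mul_sum]
  congr 1
  refine Finset.sum_congr rfl fun F hF => ?_
  have hFS := hS F (topPrimeClass_subset S p n k hF)
  have hd : p k ∣ F := by
    simp only [topPrimeClass, Finset.mem_filter] at hF
    exact hF.2.2.1
  have e : p k * (F / p k) = F := EuclideanDomain.mul_div_cancel' hp.2.ne_zero hd
  have h0 : F / p k ≠ 0 := fun h => hFS.ne_zero (by rw [← e, h, mul_zero])
  conv_rhs => rw [← e]
  rw [multExt_mul g hp.2.ne_zero h0, multExt_irreducible g hp.1 hp.2]

/-- A later $p_j$ divides no $F$ in the class, and $p_k$ does not divide $F/p_k$ because $p_k^2\nmid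
F$; no prime still to be revealed enters. -/
lemma measurable_predictableFactor {S : Finset K[X]} {p : ℕ → K[X]} {n k : ℕ}
    (hp : (p k).Monic ∧ Irreducible (p k)) (r : ℝ) :
    Measurable[primeFiltration g p n k] (predictableFactor g S p n k r) := by
  refine Measurable.const_mul (Finset.measurable_sum _ fun F hF => ?_) _
  simp only [topPrimeClass, Finset.mem_filter] at hF
  obtain ⟨-, hk, hd, hmax, hsq⟩ := hF
  have e : p k * (F / p k) = F := EuclideanDomain.mul_div_cancel' hp.2.ne_zero hd
  refine measurable_multExt fun P h1 h2 hP => measurable_primeFiltration h1 h2 ?_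
  rintro j hj hkj rfl
  have hjk : j = k := le_antisymm (hmax j hj (by rw [← e]; exact hP.mul_left _)) hkj
  subst hjk
  apply hsq j hj
  rw [← e, sq]
  exact mul_dvd_mul_left _ hP

lemma sum_card_sq_le {n : ℕ} {G : ℕ → Finset K[X]} {D m : ℝ}
    (hD : ∀ k < n, ((G k).card : ℝ) ≤ D) (hm : ∑ k ∈ Finset.range n, ((G k).card : ℝ) ≤ m)
    (hD0 : 0 ≤ D) :
    ∑ k ∈ Finset.range n, ((G k).card : ℝ) ^ 2 ≤ D * m := by
  refine le_trans ?_ (mul_le_mul_of_nonneg_left hm hD0)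
  rw [Finset.mul_sum]
  refine Finset.sum_le_sum fun k hk => ?_
  rw [sq]
  exact mul_le_mul_of_nonneg_right (hD k (Finset.mem_range.mp hk)) (Nat.cast_nonneg _)

open Classical in
/-- Quantitative bound for the characteristic function of a normalised sum of values of a
Steinhaus random multiplicative function. Here `b` bounds the proportion of exceptional elements
of `A`, `D` the number of multiples of a prime in `T`, and the remaining quantity is the
proportion of nontrivial multiplicative quadruples. -/
theorem norm_charFun_steinhausSum_sub_le [MeasurableSpace Ω] {μ : Measure Ω}
    [IsProbabilityMeasure μ] (hg : IsPrimeSteinhaus g μ)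
    {A S T : Finset K[X]} (hA : ∀ F ∈ A, F.Monic) (hSA : S ⊆ A) (hA0 : 0 < A.card)
    (hT : ∀ P ∈ T, P.Monic ∧ Irreducible P) {b D : ℝ} (hD0 : 0 ≤ D)
    (hD : ∀ P ∈ T, ((S.filter fun F => P ∣ F).card : ℝ) ≤ D)
    (hb : ((A \ S.filter fun F => (∃ P ∈ T, P ∣ F) ∧ ∀ P ∈ T, ¬ P ^ 2 ∣ F).card : ℝ)
      ≤ b * A.card) (t : ℂ) :
    ‖∫ ω, Complex.exp (((((Real.sqrt A.card : ℝ) : ℂ)⁻¹ * ∑ F ∈ A, multExt g F ω) * conj t).re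
          * Complex.I) ∂μ - (Real.exp (-(‖t‖ ^ 2 / 4)) : ℂ)‖
      ≤ ‖t‖ * Real.sqrt b
        + 65 * (‖t‖ ^ 2 / 4) ^ 2 *
          (2 * (D / A.card) + (nontrivialQuadruples S S).card / (A.card : ℝ) ^ 2)
        + 2 * (‖t‖ ^ 2 / 4) * Real.sqrt
          (D / A.card + (nontrivialQuadruples S S).card / (A.card : ℝ) ^ 2 + 2 * b) := by
  obtain ⟨p, hpmaps, hpinj, hpsurj⟩ := exists_bijOn_Iio_card T
  set n := T.card with hn
  have hpT : ∀ k < n, p k ∈ T := fun k hk => hpmaps hk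
  have hTp : ∀ P ∈ T, ∃ k < n, p k = P := fun P hP => hpsurj hP
  have hp : ∀ k < n, (p k).Monic ∧ Irreducible (p k) := fun k hk => hT _ (hpT k hk)
  have hS : ∀ F ∈ S, F.Monic := fun F hF => hA F (hSA hF)
  set a : ℝ := ((A.card : ℕ) : ℝ) with ha
  have ha0 : 0 < a := by rw [ha]; exact_mod_cast hA0
  set r : ℝ := (Real.sqrt a)⁻¹ with hr
  have hr0 : 0 ≤ r := by positivity
  have hr2 : r ^ 2 = a⁻¹ := by rw [hr, inv_pow, Real.sq_sqrt ha0.le]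
  set G := topPrimeClass S p n with hG
  set 𝒢 := (Finset.range n).biUnion G with h𝒢
  have h𝒢eq : 𝒢 = S.filter fun F => (∃ P ∈ T, P ∣ F) ∧ ∀ P ∈ T, ¬ P ^ 2 ∣ F := by
    rw [h𝒢, hG, biUnion_topPrimeClass]
    refine Finset.filter_congr fun F _ => ?_
    constructor
    · rintro ⟨⟨j, hj, h1⟩, h2⟩
      refine ⟨⟨p j, hpT j hj, h1⟩, fun P hP => ?_⟩
      obtain ⟨k, hk, rfl⟩ := hTp P hP
      exact h2 k hk
    · rintro ⟨⟨P, hP, h1⟩, h2⟩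
      obtain ⟨k, hk, rfl⟩ := hTp P hP
      exact ⟨⟨k, hk, h1⟩, fun j hj => h2 _ (hpT j hj)⟩
  rw [← h𝒢eq] at hb
  have h𝒢A : 𝒢 ⊆ A := by rw [h𝒢eq]; exact (Finset.filter_subset _ _).trans hSA
  have hdisj := disjoint_topPrimeClass S p n
  have hsum : ∀ ω, ∑ F ∈ 𝒢, multExt g F ω
      = ∑ k ∈ Finset.range n, ∑ F ∈ G k, multExt g F ω := fun ω =>
    Finset.sum_biUnion fun k _ l _ hkl => hdisj k l hkl
  have hcard : (𝒢.card : ℝ) = ∑ k ∈ Finset.range n, ((G k).card : ℝ) := by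
    rw [h𝒢, Finset.card_biUnion fun k _ l _ hkl => hdisj k l hkl]
    push_cast
    rfl
  have hcardA : ((A \ 𝒢).card : ℝ) = a - 𝒢.card := by
    rw [Finset.card_sdiff_of_subset h𝒢A, Nat.cast_sub (Finset.card_le_card h𝒢A)]
  have h𝒢a : (𝒢.card : ℝ) ≤ a := by
    rw [ha]; exact_mod_cast Finset.card_le_card h𝒢A
  set W : ℕ → Ω → ℂ := fun k => predictableFactor g S p n k r with hW
  set σ : ℕ → Ω → ℝ := fun k ω => ‖∑ F ∈ G k, multExt g F ω‖ ^ 2 with hσ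
  have hGm : ∀ k, ∀ F ∈ G k, F.Monic := fun k F hF => hS F (topPrimeClass_subset S p n k hF)
  -- Since $|g(p_k)|=1$, the predictable $|W_k|^2$ equals the squared modulus of the whole
  -- increment, whose moments count multiplicative quadruples.
  have hWσ : ∀ k < n, ∀ ω, ‖W k ω‖ ^ 2 = a⁻¹ * σ k ω := fun k hk ω => by
    have h1 : ‖W k ω‖ = ‖(r : ℂ) * ∑ F ∈ G k, multExt g F ω‖ := by
      rw [← mul_predictableFactor hS (hp k hk), norm_mul, hg.norm_eq_one, one_mul]
    rw [h1, norm_mul, mul_pow, Complex.norm_real, Real.norm_of_nonneg hr0, hr2]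
  have hsumbound : ∀ (B : Finset K[X]) ω, ‖∑ F ∈ B, multExt g F ω‖ ≤ B.card := fun B ω => by
    refine (norm_sum_le _ _).trans ?_
    simp [norm_multExt hg.norm_eq_one]
  have hsummeas : ∀ B : Finset K[X], Measurable fun ω => ∑ F ∈ B, multExt g F ω := fun B =>
    Finset.measurable_sum _ fun F _ => hg.measurable_multExt F
  have hσm : ∀ k, Measurable (σ k) := fun k => (hsummeas (G k)).norm.pow_const 2
  have hσ0 : ∀ k ω, 0 ≤ σ k ω := fun k ω => by simp only [hσ]; positivity
  have hσB : ∀ k ω, σ k ω ≤ ((G k).card : ℝ) ^ 2 := fun k ω => by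
    simp only [hσ]
    have := hsumbound (G k) ω
    gcongr
  have hσint : ∀ k, Integrable (σ k) μ := fun k => by
    refine Integrable.of_bound (C := ((G k).card : ℝ) ^ 2) (hσm k).aestronglyMeasurable ?_
    filter_upwards with ω
    rw [Real.norm_of_nonneg (hσ0 k ω)]
    exact hσB k ω
  have hσσint : ∀ k l, Integrable (fun ω => σ k ω * σ l ω) μ := fun k l => by
    refine Integrable.of_bound (C := ((G k).card : ℝ) ^ 2 * ((G l).card : ℝ) ^ 2)
      ((hσm k).mul (hσm l)).aestronglyMeasurable ?_
    filter_upwards with ω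
    rw [Real.norm_of_nonneg (mul_nonneg (hσ0 k ω) (hσ0 l ω))]
    exact mul_le_mul (hσB k ω) (hσB l ω) (hσ0 l ω) (by positivity)
  have hEσ : ∀ k, ∫ ω, σ k ω ∂μ = (G k).card := fun k => hg.integral_norm_sum_sq (hGm k)
  have hEσσ : ∀ k l, ∫ ω, σ k ω * σ l ω ∂μ = Finset.mulEnergy (G k) (G l) := fun k l =>
    hg.integral_norm_sum_sq_mul_norm_sum_sq (hGm k) (hGm l)
  have hGD : ∀ k < n, ((G k).card : ℝ) ≤ D := fun k hk => by
    refine le_trans ?_ (hD (p k) (hpT k hk))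
    refine Nat.cast_le.mpr (Finset.card_le_card fun F hF => ?_)
    simp only [hG, topPrimeClass, Finset.mem_filter] at hF ⊢
    exact ⟨hF.1, hF.2.2.1⟩
  have hsq : ∑ k ∈ Finset.range n, ((G k).card : ℝ) ^ 2 ≤ D * a :=
    sum_card_sq_le hGD (hcard ▸ h𝒢a) hD0
  set Q : ℝ := (((nontrivialQuadruples S S).card : ℕ) : ℝ) with hQ
  have hen1 : ∑ k ∈ Finset.range n, (Finset.mulEnergy (G k) (G k) : ℝ) ≤ 2 * (D * a) + Q := by
    have h1 := sum_mulEnergy_self_le (S := S) (n := n) (G := G)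
      (fun k _ => topPrimeClass_subset S p n k) hdisj
    have h2 : ∑ k ∈ Finset.range n, (Finset.mulEnergy (G k) (G k) : ℝ)
        ≤ 2 * ∑ k ∈ Finset.range n, ((G k).card : ℝ) ^ 2 + Q := by
      rw [hQ]; exact_mod_cast h1
    linarith
  have hen2 : ∑ k ∈ Finset.range n, ∑ l ∈ Finset.range n, (Finset.mulEnergy (G k) (G l) : ℝ)
      ≤ a ^ 2 + D * a + Q := by
    have h1 := sum_sum_mulEnergy_le (S := S) (n := n) (G := G)
      (fun k _ => topPrimeClass_subset S p n k) hdisj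
    have h2 : ∑ k ∈ Finset.range n, ∑ l ∈ Finset.range n, (Finset.mulEnergy (G k) (G l) : ℝ)
        ≤ (∑ k ∈ Finset.range n, ((G k).card : ℝ)) ^ 2
          + ∑ k ∈ Finset.range n, ((G k).card : ℝ) ^ 2 + Q := by
      rw [hQ]; exact_mod_cast h1
    rw [← hcard] at h2
    have h3 : (𝒢.card : ℝ) ^ 2 ≤ a ^ 2 := by gcongr
    linarith
  -- The uniform bound `B` only secures integrability and does not enter the estimate.
  have hclt := norm_integral_exp_sum_sub_gaussian_le (μ := μ) (n := n)
    (ℱ := primeFiltration g p n) (U := fun k => g (p k)) (W := W) (B := r * S.card)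
    (primeFiltration_mono p n) (primeFiltration_le hg.measurable p n)
    (fun k hk => measurable_predictableFactor (hp k hk) r)
    (fun k hk ω => by
      simp only [hW, predictableFactor, norm_mul, Complex.norm_real, Real.norm_of_nonneg hr0]
      refine mul_le_mul_of_nonneg_left ((norm_sum_le _ _).trans ?_) hr0
      simp only [norm_multExt hg.norm_eq_one, Finset.sum_const, nsmul_eq_mul, mul_one]
      exact Nat.cast_le.mpr (Finset.card_le_card (topPrimeClass_subset S p n k)))
    (fun k hk => measurable_primeFiltration (hp k hk).1 (hp k hk).2 fun j hj hkj h => by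
      have := hpinj (Set.mem_Iio.mpr hk) (Set.mem_Iio.mpr hj) h
      omega)
    (fun k hk => hg.indep_primeFiltration hk (hp k hk))
    (fun k hk => hg.map_eq _ (hp k hk).1 (hp k hk).2) t
  have eY : ∀ ω, ∑ k ∈ Finset.range n, g (p k) ω * W k ω
      = ((Real.sqrt a : ℝ) : ℂ)⁻¹ * ∑ F ∈ 𝒢, multExt g F ω := fun ω => by
    rw [hsum, Finset.mul_sum]
    refine Finset.sum_congr rfl fun k hk => ?_
    rw [hW, mul_predictableFactor hS (hp k (Finset.mem_range.mp hk)), hr, Complex.ofReal_inv]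
  simp only [eY] at hclt
  have hfourth : ∑ k ∈ Finset.range n, ∫ ω, ‖W k ω‖ ^ 4 ∂μ ≤ 2 * (D / a) + Q / a ^ 2 := by
    have e : ∀ k ∈ Finset.range n, ∫ ω, ‖W k ω‖ ^ 4 ∂μ
        = (a ^ 2)⁻¹ * Finset.mulEnergy (G k) (G k) := fun k hk => by
      rw [← hEσσ, ← integral_const_mul]
      congr 1
      funext ω
      rw [show ‖W k ω‖ ^ 4 = (‖W k ω‖ ^ 2) ^ 2 by ring, hWσ k (Finset.mem_range.mp hk)]
      ring
    rw [Finset.sum_congr rfl e, ← Finset.mul_sum]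
    refine (mul_le_mul_of_nonneg_left hen1 (by positivity)).trans_eq ?_
    field_simp
  -- With $X=\sum|W_k|^2$, the inequalities $E X^2\le 1+D/a+Q/a^2$ and $E X\ge 1-b$ bound
  -- $E(X-1)^2$; Cauchy–Schwarz then passes to $L^1$.
  have hvar : ∫ ω, |∑ k ∈ Finset.range n, ‖W k ω‖ ^ 2 - 1| ∂μ
      ≤ Real.sqrt (D / a + Q / a ^ 2 + 2 * b) := by
    set V : Ω → ℝ := fun ω => ∑ k ∈ Finset.range n, σ k ω with hV
    have hVint : Integrable V μ := integrable_finsetSum _ fun k _ => hσint k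
    have hVsq : ∀ ω, V ω ^ 2 = ∑ k ∈ Finset.range n, ∑ l ∈ Finset.range n, σ k ω * σ l ω :=
      fun ω => by rw [sq, hV, Finset.sum_mul_sum]
    have hVsqint : Integrable (fun ω => V ω ^ 2) μ := by
      simp_rw [hVsq]
      exact integrable_finsetSum _ fun k _ => integrable_finsetSum _ fun l _ => hσσint k l
    have eV : ∀ ω, ∑ k ∈ Finset.range n, ‖W k ω‖ ^ 2 = a⁻¹ * V ω := fun ω => by
      rw [hV, Finset.mul_sum]
      exact Finset.sum_congr rfl fun k hk => hWσ k (Finset.mem_range.mp hk) ω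
    simp only [eV]
    have eexp : ∀ ω, |a⁻¹ * V ω - 1| ^ 2 = (a ^ 2)⁻¹ * V ω ^ 2 - 2 * a⁻¹ * V ω + 1 := fun ω => by
      rw [sq_abs]; ring
    have hi1 : Integrable (fun ω => (a ^ 2)⁻¹ * V ω ^ 2 - 2 * a⁻¹ * V ω) μ :=
      (hVsqint.const_mul _).sub (hVint.const_mul _)
    refine (integral_le_sqrt_integral_sq ((hVint.const_mul _).sub (integrable_const _)).abs ?_).trans
      (Real.sqrt_le_sqrt ?_)
    · simp only [Pi.sub_apply, eexp]
      exact hi1.add (integrable_const _)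
    · simp only [Pi.sub_apply, eexp]
      rw [integral_add hi1 (integrable_const _),
        integral_sub (hVsqint.const_mul _) (hVint.const_mul _), integral_const_mul,
        integral_const_mul]
      have e1 : ∫ ω, V ω ∂μ = 𝒢.card := by
        rw [hcard, hV, integral_finsetSum _ fun k _ => hσint k]
        exact Finset.sum_congr rfl fun k _ => hEσ k
      have e2 : ∫ ω, V ω ^ 2 ∂μ ≤ a ^ 2 + D * a + Q := by
        simp_rw [hVsq]
        rw [integral_finsetSum _ fun k _ => integrable_finsetSum _ fun l _ => hσσint k l]
        refine le_trans (le_of_eq ?_) hen2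
        refine Finset.sum_congr rfl fun k _ => ?_
        rw [integral_finsetSum _ fun l _ => hσσint k l]
        exact Finset.sum_congr rfl fun l _ => hEσσ k l
      rw [e1]
      simp only [integral_const, probReal_univ, one_smul]
      have e3 : (a ^ 2)⁻¹ * ∫ ω, V ω ^ 2 ∂μ ≤ 1 + D / a + Q / a ^ 2 := by
        refine (mul_le_mul_of_nonneg_left e2 (by positivity)).trans_eq ?_
        field_simp
      have e4 : 1 - b ≤ a⁻¹ * 𝒢.card := by
        rw [inv_mul_eq_div, le_div_iff₀ ha0]
        linarith
      linarith
  -- By orthogonality the squared $L^2$ distance is exactly the proportion of discarded polynomials.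
  have hb' : ∫ ω, ‖((Real.sqrt a : ℝ) : ℂ)⁻¹ * ∑ F ∈ A, multExt g F ω -
      ((Real.sqrt a : ℝ) : ℂ)⁻¹ * ∑ F ∈ 𝒢, multExt g F ω‖ ^ 2 ∂μ ≤ b := by
    have e : ∀ ω, ‖((Real.sqrt a : ℝ) : ℂ)⁻¹ * ∑ F ∈ A, multExt g F ω -
        ((Real.sqrt a : ℝ) : ℂ)⁻¹ * ∑ F ∈ 𝒢, multExt g F ω‖ ^ 2
        = a⁻¹ * ‖∑ F ∈ A \ 𝒢, multExt g F ω‖ ^ 2 := fun ω => by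
      rw [← mul_sub, ← Finset.sum_sdiff h𝒢A, add_sub_cancel_right, norm_mul, mul_pow,
        ← Complex.ofReal_inv, Complex.norm_real, ← hr, Real.norm_of_nonneg hr0, hr2]
    simp_rw [e]
    rw [integral_const_mul, hg.integral_norm_sum_sq fun F hF => hA F (Finset.mem_sdiff.mp hF).1,
      inv_mul_eq_div, div_le_iff₀ ha0]
    exact hb
  have hclose := norm_integral_exp_sub_integral_exp_le (μ := μ)
    (X := fun ω => ((Real.sqrt a : ℝ) : ℂ)⁻¹ * ∑ F ∈ A, multExt g F ω)
    (Y := fun ω => ((Real.sqrt a : ℝ) : ℂ)⁻¹ * ∑ F ∈ 𝒢, multExt g F ω)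
    ((hsummeas A).const_mul _) ((hsummeas 𝒢).const_mul _) (B := r * A.card + r * 𝒢.card)
    (fun ω => by
      refine (norm_sub_le _ _).trans ?_
      simp only [norm_mul, ← Complex.ofReal_inv, Complex.norm_real, ← hr,
        Real.norm_of_nonneg hr0]
      exact add_le_add (mul_le_mul_of_nonneg_left (hsumbound A ω) hr0)
        (mul_le_mul_of_nonneg_left (hsumbound 𝒢 ω) hr0)) t
  refine (norm_sub_le_norm_sub_add_norm_sub _ _ _).trans ((add_le_add hclose hclt).trans ?_)
  rw [add_assoc]
  refine add_le_add (mul_le_mul_of_nonneg_left (Real.sqrt_le_sqrt hb') (norm_nonneg _))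
    (add_le_add (mul_le_mul_of_nonneg_left hfourth (by positivity))
      (mul_le_mul_of_nonneg_left hvar (by positivity)))

end CharFunBound

/-! ### Choice of the large primes and control of every error by the size of the set. -/

section Assembly

open ComplexConjugate

/-- The error term controlling the exceptional polynomials, as a function of `√(N log q)`. -/
noncomputable def exceptionalError (c s : ℝ) : ℝ :=
  c⁻¹ * (Real.exp 4 + 2) * (s ^ 4 * Real.exp (-(1 / 6) * s))

lemma tendsto_exceptionalError (c : ℝ) : Tendsto (exceptionalError c) atTop (𝓝 0) := by
  have h1 : Tendsto (fun s : ℝ => s / 6) atTop atTop :=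
    tendsto_id.atTop_div_const (by norm_num)
  have h2 := ((Real.tendsto_pow_mul_exp_neg_atTop_nhds_zero 4).comp h1).const_mul
    (c⁻¹ * (Real.exp 4 + 2) * 6 ^ 4)
  rw [mul_zero] at h2
  refine h2.congr fun s => ?_
  simp only [Function.comp, exceptionalError]
  rw [show -(1 / 6) * s = -(s / 6) by ring]
  ring

section

variable {K : Type*} [Field K] [Fintype K]

variable (K) in
open Classical in
/-- The monic irreducible polynomials of degree at most `N` satisfying `p`. -/
noncomputable def primesUpTo (N : ℕ) (p : K[X] → Prop) : Finset K[X] :=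
  ((Finset.range (N + 1)).biUnion (monicsOfDegree K)).filter fun P =>
    (P.Monic ∧ Irreducible P) ∧ P.natDegree ≤ N ∧ p P

lemma mem_primesUpTo {N : ℕ} {p : K[X] → Prop} {P : K[X]} :
    P ∈ primesUpTo K N p ↔ (P.Monic ∧ Irreducible P) ∧ P.natDegree ≤ N ∧ p P := by
  classical
  rw [primesUpTo, Finset.mem_filter]
  refine ⟨fun h => h.2, fun h => ⟨?_, h⟩⟩
  rw [Finset.mem_biUnion]
  exact ⟨P.natDegree, Finset.mem_range.mpr (Nat.lt_succ_of_le h.2.1), mem_monicsOfDegree h.1.1⟩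

open Classical in
/-- All but a proportion tending to zero of the elements of `A` lie in `S` and have a large prime
factor but no square of a large prime as a factor. -/
lemma card_exceptional_le {A S : Finset K[X]} {N : ℕ} (hN : 1 ≤ N)
    (hA : ∀ F ∈ A, F.Monic ∧ F.natDegree = N) (hSA : S ⊆ A) {s : ℝ}
    (hs : s = Real.sqrt (N * Real.log (Fintype.card K))) (hs1 : 1 ≤ s) {T : Finset K[X]}
    (hT : T = primesUpTo K N fun P => s / 2 < P.natDegree * Real.log (Fintype.card K)) :
    ((A \ S.filter fun F => (∃ P ∈ T, P ∣ F) ∧ ∀ P ∈ T, ¬ P ^ 2 ∣ F).card : ℝ)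
      ≤ ((A.card : ℝ) - S.card) + (Fintype.card K : ℝ) ^ N * Real.exp (-(1 / 2) * s) *
        ((Real.exp 4 + 2) * s ^ 4) := by
  set q : ℝ := ((Fintype.card K : ℕ) : ℝ) with hq
  have hq2 : (2 : ℝ) ≤ q := by
    rw [hq]; exact_mod_cast (Fintype.one_lt_card : 1 < Fintype.card K)
  have hlog : 1 / 2 ≤ Real.log q :=
    (by linarith [Real.log_two_gt_d9] : (1 : ℝ) / 2 ≤ Real.log 2).trans
      (Real.log_le_log (by norm_num) hq2)
  have hL0 : 0 ≤ N * Real.log q := by positivity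
  have hss : s ^ 2 = N * Real.log q := by rw [hs, Real.sq_sqrt hL0]
  have hs0 : 0 < s := by linarith
  set A₁ := A.filter fun F => ∀ P ∈ T, ¬ P ∣ F with hA₁
  set A₂ := A.filter fun F => ∃ P ∈ T, P ^ 2 ∣ F with hA₂
  have hsub : (A \ S.filter fun F => (∃ P ∈ T, P ∣ F) ∧ ∀ P ∈ T, ¬ P ^ 2 ∣ F)
      ⊆ (A \ S) ∪ A₁ ∪ A₂ := by
    intro F hF
    rw [Finset.mem_sdiff, Finset.mem_filter] at hF
    simp only [Finset.mem_union, Finset.mem_sdiff, hA₁, hA₂, Finset.mem_filter]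
    by_cases h1 : F ∈ S
    · by_cases h2 : ∃ P ∈ T, P ∣ F
      · refine Or.inr ⟨hF.1, ?_⟩
        by_contra! h3
        exact hF.2 ⟨h1, h2, h3⟩
      · push Not at h2
        exact Or.inl (Or.inr ⟨hF.1, h2⟩)
    · exact Or.inl (Or.inl ⟨hF.1, h1⟩)
  have hcard : ((A \ S.filter fun F => (∃ P ∈ T, P ∣ F) ∧ ∀ P ∈ T, ¬ P ^ 2 ∣ F).card : ℝ)
      ≤ ((A \ S).card : ℝ) + A₁.card + A₂.card := by
    exact_mod_cast (Finset.card_le_card hsub).trans ((Finset.card_union_le _ _).trans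
      (Nat.add_le_add_right (Finset.card_union_le _ _) _))
  have hAS : ((A \ S).card : ℝ) = A.card - S.card := by
    rw [Finset.card_sdiff_of_subset hSA, Nat.cast_sub (Finset.card_le_card hSA)]
  set R := primesUpTo K N fun P => P.natDegree * Real.log (Fintype.card K) ≤ s / 2 with hR
  have hm1 : (1 : ℝ) ≤ ⌊s⌋₊ := by exact_mod_cast Nat.le_floor (by simpa using hs1)
  have h1 := card_smooth_le (A := A₁) (Q := R) hN (fun F hF => hA F (Finset.mem_filter.mp hF).1)
    (fun P hP => (mem_primesUpTo.mp hP).1) (fun F hF P hP1 hP2 hPF => by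
      rw [Finset.mem_filter] at hF
      have hdeg : P.natDegree ≤ N := by
        rw [← (hA F hF.1).2]
        exact natDegree_le_of_dvd hPF (hA F hF.1).1.ne_zero
      refine mem_primesUpTo.mpr ⟨⟨hP1, hP2⟩, hdeg, ?_⟩
      by_contra! hc
      exact hF.2 P (by rw [hT]; exact mem_primesUpTo.mpr ⟨⟨hP1, hP2⟩, hdeg, hc⟩) hPF)
    (fun P hP => by rw [← hs]; exact (mem_primesUpTo.mp hP).2.2) (m := ⌊s⌋₊)
    -- As $\log q\ge 1/2$, the condition $\deg P\cdot\log q\le s/2$ gives $\deg P\le s$, so the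
    -- Mertens factor is a power of $s$, uniformly in $q$.
    (fun P hP => Nat.le_floor (by
      have h := (mem_primesUpTo.mp hP).2.2
      have h0 : (0 : ℝ) ≤ P.natDegree := Nat.cast_nonneg _
      nlinarith))
  rw [← hs] at h1
  have h1' : Real.exp (4 * (1 + Real.log ⌊s⌋₊)) ≤ Real.exp 4 * s ^ 4 := by
    have hlogm : Real.log ⌊s⌋₊ ≤ Real.log s :=
      Real.log_le_log (by linarith) (Nat.floor_le hs0.le)
    calc Real.exp (4 * (1 + Real.log ⌊s⌋₊)) ≤ Real.exp (4 + (4 : ℕ) * Real.log s) :=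
          Real.exp_le_exp.mpr (by push_cast; linarith)
      _ = Real.exp 4 * s ^ 4 := by
          rw [Real.exp_add, Real.exp_nat_mul, Real.exp_log hs0]
  have h2 := card_sq_dvd_le (A := A₂) (T := T) (N := N) (y := Real.exp (1 / 2 * s))
    (Real.exp_pos _) (fun F hF => hA F (Finset.mem_filter.mp hF).1)
    (fun P hP => by rw [hT] at hP; exact (mem_primesUpTo.mp hP).1)
    (fun P hP => by rw [hT] at hP; exact (mem_primesUpTo.mp hP).2.1)
    (fun P hP => by
      rw [hT] at hP
      have h := (mem_primesUpTo.mp hP).2.2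
      rw [← hq, ← Real.exp_log (show 0 < q by linarith), ← Real.exp_nat_mul]
      exact Real.exp_le_exp.mpr (by linarith))
    (fun F hF => (Finset.mem_filter.mp hF).2)
  rw [← Real.exp_neg, show -(1 / 2 * s) = -(1 / 2) * s by ring] at h2
  have hN1 : (1 : ℝ) ≤ N := by exact_mod_cast hN
  have h2' : 1 + Real.log N ≤ 2 * s ^ 4 := by
    have e1 : Real.log N ≤ N - 1 := Real.log_le_sub_one_of_pos (by linarith)
    have e2 : (N : ℝ) ≤ 2 * s ^ 2 := by rw [hss]; nlinarith
    have e3 : s ^ 2 ≤ s ^ 4 := pow_le_pow_right₀ hs1 (by norm_num)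
    linarith
  have hY0 : 0 ≤ q ^ N * Real.exp (-(1 / 2) * s) := by positivity
  have h3 := mul_le_mul_of_nonneg_left h1' hY0
  have h4 := mul_le_mul_of_nonneg_left h2' hY0
  rw [← hq] at h1 h2
  rw [hAS] at hcard
  linarith

variable {Ω : Type*} [MeasurableSpace Ω] {g : K[X] → Ω → ℂ} {μ : Measure Ω}

lemma norm_charFun_steinhausSum_sub_le_of_size [IsProbabilityMeasure μ]
    (hg : IsPrimeSteinhaus g μ) {A S : Finset K[X]} {N : ℕ} (hN : 1 ≤ N)
    (hA : ∀ F ∈ A, F.Monic ∧ F.natDegree = N) (hSA : S ⊆ A) (hS0 : 0 < S.card) {s c : ℝ}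
    (hs : s = Real.sqrt (N * Real.log (Fintype.card K))) (hs1 : 1 ≤ s) (hc : 0 < c)
    (hsize : c * ((Fintype.card K : ℝ) ^ N * Real.exp (-(1 / 3) * s)) ≤ A.card) (t : ℂ) :
    ‖∫ ω, Complex.exp (((((Real.sqrt A.card : ℝ) : ℂ)⁻¹ * ∑ F ∈ A, multExt g F ω) * conj t).re
          * Complex.I) ∂μ - (Real.exp (-(‖t‖ ^ 2 / 4)) : ℂ)‖
      ≤ ‖t‖ * Real.sqrt ((1 - (S.card : ℝ) / A.card) + exceptionalError c s)
        + 65 * (‖t‖ ^ 2 / 4) ^ 2 * (2 * exceptionalError c s +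
          (|(multEnergy S : ℝ) / (S.card : ℝ) ^ 2 - 2| + exceptionalError c s))
        + 2 * (‖t‖ ^ 2 / 4) * Real.sqrt (exceptionalError c s +
          (|(multEnergy S : ℝ) / (S.card : ℝ) ^ 2 - 2| + exceptionalError c s)
          + 2 * ((1 - (S.card : ℝ) / A.card) + exceptionalError c s)) := by
  classical
  set q : ℝ := ((Fintype.card K : ℕ) : ℝ) with hq
  have hq2 : (2 : ℝ) ≤ q := by
    rw [hq]; exact_mod_cast (Fintype.one_lt_card : 1 < Fintype.card K)
  have hA0 : 0 < A.card := hS0.trans_le (Finset.card_le_card hSA)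
  set a : ℝ := ((A.card : ℕ) : ℝ) with ha
  have ha0 : 0 < a := by rw [ha]; exact_mod_cast hA0
  set σ : ℝ := ((S.card : ℕ) : ℝ) with hσ
  have hσ0 : 0 < σ := by rw [hσ]; exact_mod_cast hS0
  have hσa : σ ≤ a := by rw [hσ, ha]; exact_mod_cast Finset.card_le_card hSA
  set D := q ^ N * Real.exp (-(1 / 2) * s) with hD
  have hD0 : 0 ≤ D := by positivity
  set T := primesUpTo K N fun P => s / 2 < P.natDegree * Real.log (Fintype.card K) with hT
  have hs4 : 1 ≤ s ^ 4 := one_le_pow₀ hs1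
  have hDbig : D * ((Real.exp 4 + 2) * s ^ 4) ≤ exceptionalError c s * a := by
    have e : D * ((Real.exp 4 + 2) * s ^ 4)
        = exceptionalError c s * (c * (q ^ N * Real.exp (-(1 / 3) * s))) := by
      -- The saving $e^{-s/2}$ beats the loss $e^{-s/3}$ allowed by the size hypothesis, leaving
      -- $e^{-s/6}$.
      have e1 : Real.exp (-(1 / 2) * s) = Real.exp (-(1 / 6) * s) * Real.exp (-(1 / 3) * s) := by
        rw [← Real.exp_add]; congr 1; ring
      rw [hD, exceptionalError, e1]
      field_simp
    rw [e]
    refine mul_le_mul_of_nonneg_left hsize ?_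
    rw [exceptionalError]
    positivity
  have hDe : D ≤ exceptionalError c s * a := by
    refine le_trans (le_mul_of_one_le_right hD0 ?_) hDbig
    nlinarith [Real.exp_pos 4]
  have hDa : D / a ≤ exceptionalError c s := (div_le_iff₀ ha0).mpr hDe
  have hlog : 0 ≤ Real.log q := Real.log_nonneg (by linarith)
  -- Here $q^N=e^{s^2}$ and $s\ge1$. Together with $D\le\varepsilon a$ this yields $\sigma\le
  -- a\le\varepsilon a^2$, which absorbs the diagonal quadruples into the error.
  have hD1 : 1 ≤ D := by
    have hss : s ^ 2 = N * Real.log q := by rw [hs, Real.sq_sqrt (by positivity)]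
    have : q ^ N = Real.exp (s ^ 2) := by
      rw [hss, Real.exp_nat_mul, Real.exp_log (by linarith)]
    rw [hD, this, ← Real.exp_add]
    exact Real.one_le_exp (by nlinarith)
  have hQ : ((nontrivialQuadruples S S).card : ℝ) / a ^ 2
      ≤ |(multEnergy S : ℝ) / σ ^ 2 - 2| + exceptionalError c s := by
    have h1 : ((nontrivialQuadruples S S).card : ℝ) + 2 * σ ^ 2 ≤ multEnergy S + σ := by
      rw [hσ, multEnergy]; exact_mod_cast card_nontrivialQuadruples_add_le S
    have h2 : ((multEnergy S : ℝ) / σ ^ 2 - 2) * σ ^ 2 = multEnergy S - 2 * σ ^ 2 := by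
      field_simp
    have h3 : ((multEnergy S : ℝ) / σ ^ 2 - 2) * σ ^ 2
        ≤ |(multEnergy S : ℝ) / σ ^ 2 - 2| * a ^ 2 :=
      mul_le_mul (le_abs_self _) (by gcongr) (by positivity) (abs_nonneg _)
    have h4 : σ ≤ exceptionalError c s * a ^ 2 := by
      nlinarith
    rw [div_le_iff₀ (by positivity)]
    linarith
  have hb : ((A \ S.filter fun F => (∃ P ∈ T, P ∣ F) ∧ ∀ P ∈ T, ¬ P ^ 2 ∣ F).card : ℝ)
      ≤ ((1 - σ / a) + exceptionalError c s) * a := by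
    have h := card_exceptional_le hN hA hSA hs hs1 hT
    rw [← ha, ← hσ, ← hq, ← hD] at h
    have : (1 - σ / a) * a = a - σ := by field_simp
    rw [add_mul (1 - σ / a), this]
    linarith
  have hmul : ∀ P ∈ T, ((S.filter fun F => P ∣ F).card : ℝ) ≤ D := fun P hP => by
    have hP' := mem_primesUpTo.mp hP
    have h1 := card_multiples_mul_le (A := S.filter fun F => P ∣ F) (N := N)
      (fun F hF => hA F (hSA (Finset.mem_filter.mp hF).1)) hP'.1.1
      (fun F hF => (Finset.mem_filter.mp hF).2)
    have h2 : ((S.filter fun F => P ∣ F).card : ℝ) * q ^ P.natDegree ≤ q ^ N := by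
      rw [hq]; exact_mod_cast h1
    have h3 : Real.exp (1 / 2 * s) ≤ q ^ P.natDegree := by
      rw [← Real.exp_log (show 0 < q by linarith), ← Real.exp_nat_mul]
      exact Real.exp_le_exp.mpr (by linarith [hP'.2.2])
    have h4 : ((S.filter fun F => P ∣ F).card : ℝ) * Real.exp (1 / 2 * s) ≤ q ^ N :=
      (mul_le_mul_of_nonneg_left h3 (Nat.cast_nonneg _)).trans h2
    rw [hD, show -(1 / 2) * s = -(1 / 2 * s) by ring, Real.exp_neg, ← div_eq_mul_inv,
      le_div_iff₀ (Real.exp_pos _)]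
    exact h4
  refine (norm_charFun_steinhausSum_sub_le hg (fun F hF => (hA F hF).1) hSA hA0
    (fun P hP => (mem_primesUpTo.mp hP).1) hD0 hmul hb t).trans ?_
  gcongr

end

end Assembly

/-! ### Passage to the limit. -/

section Limit

open ComplexConjugate

lemma inner_eq_re_mul_conj (x t : ℂ) : inner ℝ x t = (x * conj t).re := by
  rw [Complex.inner, ← Complex.conj_re]
  simp [mul_comm]

lemma charFun_stdComplexNormal (t : ℂ) :
    charFun stdComplexNormal t = (Real.exp (-(‖t‖ ^ 2 / 4)) : ℂ) := by
  rw [charFun_apply, stdComplexNormal, integral_map_equiv]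
  have e : ∀ p : ℝ × ℝ, Complex.exp
      ((inner ℝ (Complex.measurableEquivRealProd.symm p) t : ℝ) * Complex.I)
      = Complex.exp ((inner ℝ p.1 t.re : ℝ) * Complex.I) *
        Complex.exp ((inner ℝ p.2 t.im : ℝ) * Complex.I) := fun p => by
    rw [← Complex.exp_add, inner_eq_re_mul_conj]
    congr 1
    simp [Complex.measurableEquivRealProd_symm_apply]
    ring
  simp_rw [e]
  rw [integral_prod_mul (f := fun x : ℝ => Complex.exp ((inner ℝ x t.re : ℝ) * Complex.I))
    (g := fun x : ℝ => Complex.exp ((inner ℝ x t.im : ℝ) * Complex.I)),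
    ← charFun_apply, ← charFun_apply, charFun_gaussianReal, charFun_gaussianReal,
    ← Complex.exp_add, Complex.ofReal_exp, ← Complex.normSq_eq_norm_sq, Complex.normSq_apply]
  congr 1
  push_cast
  ring

lemma IsSteinhaus.aemeasurable_sum {K Ω : Type*} [Field K] [MeasurableSpace Ω]
    {f : K[X] → Ω → ℂ} {μ : Measure Ω} (hf : IsSteinhaus f μ) {A : Finset K[X]}
    (hA : ∀ F ∈ A, F.Monic) (r : ℂ) : AEMeasurable (fun ω => r * ∑ F ∈ A, f F ω) μ := by
  obtain ⟨g, hg, hfg⟩ := hf.exists_isPrimeSteinhaus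
  refine AEMeasurable.const_mul (Finset.aemeasurable_fun_sum _ fun F hF => ?_) _
  exact ((hg.measurable_multExt F).aemeasurable).congr (hfg F (hA F hF)).symm

variable {ι : Type*} {l : Filter ι}

/-- Pointwise convergence of the characteristic functions of normalised sums of Steinhaus random
multiplicative functions, along an arbitrary filter. -/
theorem tendsto_charFun_steinhausSum (K : ι → Type*) [∀ i, Field (K i)] [∀ i, Fintype (K i)]
    (N : ι → ℕ) (hN : ∀ i, 1 ≤ N i)
    (hlim : Tendsto (fun i => Fintype.card (K i) ^ N i) l atTop)
    (A S : ∀ i, Finset (K i)[X])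
    (hA : ∀ i, ∀ F ∈ A i, F.Monic ∧ F.natDegree = N i) {c : ℝ} (hc : 0 < c)
    (hsize : ∀ᶠ i in l, c * ((Fintype.card (K i) : ℝ) ^ N i *
        Real.exp (-(1 / 3) * Real.sqrt (N i * Real.log (Fintype.card (K i))))) ≤ (A i).card)
    (hSA : ∀ i, S i ⊆ A i)
    (hS : Tendsto (fun i => ((S i).card : ℝ) / (A i).card) l (𝓝 1))
    (henergy : Tendsto (fun i => (multEnergy (S i) : ℝ) / ((S i).card : ℝ) ^ 2) l (𝓝 2))
    {Ω : ι → Type*} [∀ i, MeasurableSpace (Ω i)]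
    (μ : ∀ i, Measure (Ω i)) [∀ i, IsProbabilityMeasure (μ i)]
    (f : ∀ i, (K i)[X] → Ω i → ℂ) (hf : ∀ i, IsSteinhaus (f i) (μ i)) (t : ℂ) :
    Tendsto (fun i => charFun ((μ i).map
        fun ω => ((Real.sqrt (A i).card : ℝ) : ℂ)⁻¹ * ∑ F ∈ A i, f i F ω) t)
      l (𝓝 (charFun stdComplexNormal t)) := by
  choose g hg hfg using fun i => (hf i).exists_isPrimeSteinhaus
  have hchar : ∀ i, charFun ((μ i).map
      fun ω => ((Real.sqrt (A i).card : ℝ) : ℂ)⁻¹ * ∑ F ∈ A i, f i F ω) t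
      = ∫ ω, Complex.exp (((((Real.sqrt (A i).card : ℝ) : ℂ)⁻¹ *
        ∑ F ∈ A i, multExt (g i) F ω) * conj t).re * Complex.I) ∂(μ i) := fun i => by
    rw [charFun_apply, integral_map ((hf i).aemeasurable_sum (fun F hF => (hA i F hF).1) _)
      (by apply Measurable.aestronglyMeasurable; fun_prop)]
    refine integral_congr_ae ?_
    have hall : ∀ᵐ ω ∂(μ i), ∀ F ∈ A i, f i F ω = multExt (g i) F ω :=
      (Finset.eventually_all _).mpr fun F hF => hfg i F (hA i F hF).1
    filter_upwards [hall] with ω hω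
    rw [inner_eq_re_mul_conj, Finset.sum_congr rfl hω]
  set s : ι → ℝ := fun i => Real.sqrt (N i * Real.log (Fintype.card (K i))) with hs
  have hslim : Tendsto s l atTop := by
    have h1 := (Real.tendsto_sqrt_atTop.comp Real.tendsto_log_atTop).comp
      (tendsto_natCast_atTop_atTop.comp hlim)
    refine h1.congr fun i => ?_
    simp only [Function.comp, hs]
    rw [Nat.cast_pow, Real.log_pow]
  have hε : Tendsto (fun i => exceptionalError c (s i)) l (𝓝 0) :=
    (tendsto_exceptionalError c).comp hslim
  have hρ : Tendsto (fun i => 1 - ((S i).card : ℝ) / (A i).card) l (𝓝 0) := by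
    simpa using hS.const_sub 1
  have he : Tendsto (fun i => |(multEnergy (S i) : ℝ) / ((S i).card : ℝ) ^ 2 - 2|) l (𝓝 0) := by
    simpa using (henergy.sub_const 2).abs
  simp_rw [hchar]
  rw [charFun_stdComplexNormal, tendsto_iff_norm_sub_tendsto_zero]
  have hbound := (((hρ.add hε).sqrt.const_mul ‖t‖).add
    (((hε.const_mul 2).add (he.add hε)).const_mul (65 * (‖t‖ ^ 2 / 4) ^ 2))).add
    (((hε.add (he.add hε)).add ((hρ.add hε).const_mul 2)).sqrt.const_mul (2 * (‖t‖ ^ 2 / 4)))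
  simp only [add_zero, mul_zero, Real.sqrt_zero] at hbound
  refine squeeze_zero' (Eventually.of_forall fun i => norm_nonneg _) ?_ hbound
  -- Since $0/0=0$ here, a positive ratio forces `S i` to be nonempty.
  have hSpos : ∀ᶠ i in l, 0 < ((S i).card : ℝ) / (A i).card :=
    hS.eventually (lt_mem_nhds one_pos)
  filter_upwards [hsize, hslim.eventually_ge_atTop 1, hSpos] with i h1 h2 h3
  have hS0 : 0 < (S i).card := by
    by_contra h
    have : (S i).card = 0 := by omega
    simp [this] at h3
  exact norm_charFun_steinhausSum_sub_le_of_size (hg i) (hN i) (hA i) (hSA i) hS0 rfl h2 hc h1 t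

end Limit

theorem theorem1p1 {ι : Type*} {l : Filter ι}
    -- the finite fields and the degrees, which may vary together arbitrarily
    (K : ι → Type*) [∀ i, Field (K i)] [∀ i, Fintype (K i)]
    (N : ι → ℕ) (hN : ∀ i, 1 ≤ N i)
    (hlim : Tendsto (fun i => Fintype.card (K i) ^ N i) l atTop)
    -- the sets of monic polynomials of degree `N`
    (A S : ∀ i, Finset (K i)[X])
    (hA : ∀ i, ∀ F ∈ A i, F.Monic ∧ F.natDegree = N i)
    (hsize : ∃ c : ℝ, 0 < c ∧ ∀ᶠ i in l,
      c * ((Fintype.card (K i) : ℝ) ^ N i *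
        Real.exp (-(1 / 3) * Real.sqrt (N i * Real.log (Fintype.card (K i))))) ≤ (A i).card)
    (hSA : ∀ i, S i ⊆ A i)
    (hS : Tendsto (fun i => ((S i).card : ℝ) / (A i).card) l (𝓝 1))
    (henergy : Tendsto (fun i => (multEnergy (S i) : ℝ) / ((S i).card : ℝ) ^ 2) l (𝓝 2))
    -- the Steinhaus random multiplicative functions
    {Ω : ι → Type*} [∀ i, MeasurableSpace (Ω i)]
    (μ : ∀ i, Measure (Ω i)) [∀ i, IsProbabilityMeasure (μ i)]
    (f : ∀ i, (K i)[X] → Ω i → ℂ) (hf : ∀ i, IsSteinhaus (f i) (μ i)) :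
    TendstoInDistribution
      (fun i ω => ((Real.sqrt (A i).card : ℝ) : ℂ)⁻¹ * ∑ F ∈ A i, f i F ω)
      l id μ stdComplexNormal := by
  refine ⟨fun i => (hf i).aemeasurable_sum (fun F hF => (hA i F hF).1) _, aemeasurable_id, ?_⟩
  obtain ⟨c, hc, hsize⟩ := hsize
  -- Lévy's theorem needs sequences: pass to the coarsest filter satisfying the hypotheses,
  -- which is countably generated.
  set E : Set ι := {i | c * ((Fintype.card (K i) : ℝ) ^ N i *
    Real.exp (-(1 / 3) * Real.sqrt (N i * Real.log (Fintype.card (K i))))) ≤ (A i).card} with hE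
  set l' : Filter ι := comap (fun i => Fintype.card (K i) ^ N i) atTop ⊓
    comap (fun i => ((S i).card : ℝ) / (A i).card) (𝓝 1) ⊓
    comap (fun i => (multEnergy (S i) : ℝ) / ((S i).card : ℝ) ^ 2) (𝓝 2) ⊓ 𝓟 E with hl'
  have hle : l ≤ l' := le_inf (le_inf (le_inf (tendsto_iff_comap.mp hlim)
    (tendsto_iff_comap.mp hS)) (tendsto_iff_comap.mp henergy)) (le_principal_iff.mpr hsize)
  refine Tendsto.mono_left ?_ hle
  -- Convergence along `l'` may be tested on sequences: it is a finite infimum of comaps of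
  -- countably generated filters and a principal filter.
  refine tendsto_of_seq_tendsto fun u hu => ?_
  refine ProbabilityMeasure.tendsto_iff_tendsto_charFun.mpr fun t => ?_
  have h12 : l' ≤ comap (fun i => Fintype.card (K i) ^ N i) atTop ⊓
    comap (fun i => ((S i).card : ℝ) / (A i).card) (𝓝 1) := inf_le_left.trans inf_le_left
  have key := (tendsto_charFun_steinhausSum (l := l') K N hN
    (tendsto_comap.mono_left (h12.trans inf_le_left)) A S hA hc
    (le_principal_iff.mp inf_le_right) hSA
    (tendsto_comap.mono_left (h12.trans inf_le_right))
    (tendsto_comap.mono_left (inf_le_left.trans inf_le_right)) μ f hf t).comp hu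
  simp only [ProbabilityMeasure.coe_mk, Measure.map_id]
  exact key
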